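/- **Theorem 3.1.** Let $X\subset\mathbb P^n$ be an irreducible complex projective variety, and let $N_X\subset\mathbb P^n\times\mathbb P^n$ be its conormal variety, the Zariski closure of $\{(p,q): p\in X_{reg},\ q\perp T_pX\}$. Let $X^*\subset\mathbb P^n$, the projection of $N_X$ to the second factor, be its dual variety, and let $X^*$ have codimension $c$. Let $g_1,\dots,g_l\in\mathbb C[q_0,\dots,q_n]$ be homogeneous polynomials that define $X^*$, i.e. their zero set is $X^*$ and the scheme they define is generically reduced (for instance, generators of the ideal of $X^*$). (If $X=\mathbb P^n$, so that $X^*=\emptyset$, the affine cone over $X^*$ is taken to be $\{0\}$; thus $c=n+1$ and $g_1,\dots,g_l$ generate $(q_0,\dots,q_n)$.) Let $X'=\{[p_0:\dots:p_n:p_s] : [p_0:\dots:p_n]\in X,\ p_s=p_0+\dots+p_n\}\subset\mathbb P^{n+1}$. For $u\in\mathbb C^{n+1}$ put $u_+=u_0+\dots+u_n$ and let $$\mathcal B_X(u)=\{b : (p,b)\in N_{X'},\ [p_0b_0:\dots:p_nb_n:p_sb_s]=[u_0:\dots:u_n:-u_+]\text{ for some }p\}\subset\mathbb P^{n+1}.$$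 Let $J$ be the Jacobian matrix $(\partial g_j/\partial q_i)$ evaluated at $q=(b_0+b_s,\dots,b_n+b_s)$. In $\mathbb C[b_0,\dots,b_n,b_s]$ let $I_u$ be the ideal generated by $g_j(b_0+b_s,\dots,b_n+b_s)$, $j=1,\dots,l$, and the $(c+1)\times(c+1)$ minors of $$\begin{bmatrix} \frac{u_0}{b_0}\ \cdots\ \frac{u_n}{b_n}\\ J\end{bmatrix}\begin{bmatrix} b_0&&\\&\ddots&\\&&b_n\end{bmatrix},$$ and let $S$ be the ideal generated by the $c\times c$ minors of $J$. Let $$W_u = I_u : \big((b_0b_1\cdots b_nb_s)\cdot S\big)^\infty .$$ Then for generic data $u$, i.e. for all $u\in\mathbb C^{n+1}$ outside the zero set of some nonzero polynomial in $u_0,\dots,u_n$ (which may depend on $X$ and $g_1,\dots,g_l$), the set $\mathcal B_X(u)$ is the variety in $\mathbb P^{n+1}$ of the ideal $W_u$. For such $u$ this variety is also the set of critical points of $l'_u(b)=b_0^{u_0}\cdots b_n^{u_n}b_s^{-u_+}$ on the dual variety $X'^*$ of $X'$, i.e. of the regular points $b$ of $X'^*$ with all coordinates nonzero at which $[\frac{u_0}{b_0}:\dots:\frac{u_n}{b_n}:\frac{-u_+}{b_s}]$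 is orthogonal to $T_bX'^*$. -/

import Mathlib

open MvPolynomial

noncomputable section

namespace DualMLE

/-- Complex projective space with homogeneous coordinates indexed by `σ`. -/
abbrev ProjSpace (σ : Type) : Type := Projectivization ℂ (σ → ℂ)

/-- The common zeros in projective space of a set of homogeneous polynomials. -/
def projZeros {σ : Type} (S : Set (MvPolynomial σ ℂ)) : Set (ProjSpace σ) :=
  {x | ∀ f ∈ S, eval x.rep f = 0}

/-- The affine cone over a subset of projective space. It always contains the origin; in
particular the cone over the empty set is `{0}`. -/
def affineCone {σ : Type} (X : Set (ProjSpace σ)) : Set (σ → ℂ) :=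
  {v | ∀ hv : v ≠ 0, Projectivization.mk ℂ v hv ∈ X}

/-- The homogeneous ideal of a subset of projective space: the polynomials that vanish on the
affine cone. -/
def homIdeal {σ : Type} (X : Set (ProjSpace σ)) : Ideal (MvPolynomial σ ℂ) :=
  vanishingIdeal ℂ (affineCone X)

/-- Irreducible projective varieties. -/
structure IsProjectiveVariety {σ : Type} (X : Set (ProjSpace σ)) : Prop where
  nonempty : X.Nonempty
  closed : ∃ S : Set (MvPolynomial σ ℂ), (∀ f ∈ S, ∃ d, f.IsHomogeneous d) ∧ X = projZeros S
  irreducible : (homIdeal X).IsPrime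

/-- The dimension of the affine cone over `X`, that is `dim X + 1`. -/
def coneDim {σ : Type} (X : Set (ProjSpace σ)) : WithBot ℕ∞ :=
  ringKrullDim (MvPolynomial σ ℂ ⧸ homIdeal X)

/-- `X` has codimension `c` in projective space (the empty set, whose affine cone is the origin,
has codimension the number of homogeneous coordinates). -/
def HasCodim {σ : Type} [Fintype σ] (X : Set (ProjSpace σ)) (c : ℕ) : Prop :=
  coneDim X + (c : WithBot ℕ∞) = (Fintype.card σ : WithBot ℕ∞)

/-- The tangent space `T_p X`, as a linear subspace of the space of homogeneous coordinates
(the tangent space of the affine cone). -/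
def tangentSpace {σ : Type} [Fintype σ] (X : Set (ProjSpace σ)) (p : ProjSpace σ) :
    Submodule ℂ (σ → ℂ) where
  carrier := {v | ∀ f ∈ homIdeal X, ∑ i, eval p.rep (pderiv i f) * v i = 0}
  zero_mem' := by
    intro f _
    simp
  add_mem' := by
    intro v w hv hw f hf
    simp only [Pi.add_apply, mul_add, Finset.sum_add_distrib, hv f hf, hw f hf, add_zero]
  smul_mem' := by
    intro a v hv f hf
    have h := hv f hf
    simp only [Pi.smul_apply, smul_eq_mul]
    calc ∑ i, eval p.rep (pderiv i f) * (a * v i)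
        = a * ∑ i, eval p.rep (pderiv i f) * v i := by
          rw [Finset.mul_sum]
          exact Finset.sum_congr rfl (fun i _ => by ring)
      _ = 0 := by rw [h, mul_zero]

/-- `X_reg`: the points of `X` at which the tangent space has the dimension of `X`. -/
def regularPoints {σ : Type} [Fintype σ] (X : Set (ProjSpace σ)) : Set (ProjSpace σ) :=
  {p | p ∈ X ∧ ((Module.finrank ℂ (tangentSpace X p) : ℕ) : WithBot ℕ∞) = coneDim X}

/-- `F` is homogeneous of degree `d` in the first group of variables and of degree `e` in the
second one. -/
def IsBihomogeneous {σ τ : Type} (F : MvPolynomial (σ ⊕ τ) ℂ) (d e : ℕ) : Prop :=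
  F.IsWeightedHomogeneous (Sum.elim (fun _ => 1) (fun _ => 0) : σ ⊕ τ → ℕ) d ∧
    F.IsWeightedHomogeneous (Sum.elim (fun _ => 0) (fun _ => 1) : σ ⊕ τ → ℕ) e

/-- The Zariski closure in a product of two projective spaces. -/
def biClosure {σ τ : Type} (Z : Set (ProjSpace σ × ProjSpace τ)) :
    Set (ProjSpace σ × ProjSpace τ) :=
  {x | ∀ (F : MvPolynomial (σ ⊕ τ) ℂ) (d e : ℕ), IsBihomogeneous F d e →
    (∀ z ∈ Z, eval (Sum.elim z.1.rep z.2.rep) F = 0) → eval (Sum.elim x.1.rep x.2.rep) F = 0}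

/-- The conormal variety `N_X`: the closure of `{(p, q) : p ∈ X_reg, q ⟂ T_p X}`. -/
def conormalVariety {σ : Type} [Fintype σ] (X : Set (ProjSpace σ)) :
    Set (ProjSpace σ × ProjSpace σ) :=
  biClosure {x | x.1 ∈ regularPoints X ∧ ∀ v ∈ tangentSpace X x.1, ∑ i, x.2.rep i * v i = 0}

/-- The dual variety: the projection of the conormal variety to the second factor. -/
def dualVariety {σ : Type} [Fintype σ] (X : Set (ProjSpace σ)) : Set (ProjSpace σ) :=
  Prod.snd '' conormalVariety X

/-- The copy `X'` of `X` in the projective space with one more coordinate `p_s` (the last one):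
the points `[p_0 : ⋯ : p_n : p_s]` with `[p_0 : ⋯ : p_n] ∈ X` and `p_s = p_0 + ⋯ + p_n`. -/
def sumEmbedding {n : ℕ} (X : Set (ProjSpace (Fin (n + 1)))) : Set (ProjSpace (Fin (n + 2))) :=
  {x | (fun i : Fin (n + 1) => x.rep i.castSucc) ∈ affineCone X ∧
    x.rep (Fin.last (n + 1)) = ∑ i : Fin (n + 1), x.rep i.castSucc}

/-- The vector `(u_0, …, u_n, -u_+)`. -/
def extData {n : ℕ} (u : Fin (n + 1) → ℂ) : Fin (n + 2) → ℂ :=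
  Fin.snoc (α := fun _ => ℂ) u (-∑ i, u i)

/-- The likelihood locus `L_X(u)`: the points `(p, b)` of the conormal variety of `X'` with
`[p_0 b_0 : ⋯ : p_n b_n : p_s b_s] = [u_0 : ⋯ : u_n : -u_+]`. -/
def likelihoodLocus {n : ℕ} (X : Set (ProjSpace (Fin (n + 1)))) (u : Fin (n + 1) → ℂ) :
    Set (ProjSpace (Fin (n + 2)) × ProjSpace (Fin (n + 2))) :=
  {x | x ∈ conormalVariety (sumEmbedding X) ∧
    ∃ t : ℂ, t ≠ 0 ∧ ∀ i, x.1.rep i * x.2.rep i = t * extData u i}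

/-- `B_X(u) = {b : (p, b) ∈ L_X(u)}`. -/
def dualLikelihoodLocus {n : ℕ} (X : Set (ProjSpace (Fin (n + 1)))) (u : Fin (n + 1) → ℂ) :
    Set (ProjSpace (Fin (n + 2))) :=
  Prod.snd '' likelihoodLocus X u

/-- The critical points of `b_0 ^ u_0 ⋯ b_n ^ u_n * b_s ^ (-u_+)` on the dual variety of `X'`:
the regular points with nonzero coordinates at which the gradient
`(u_0 / b_0, …, u_n / b_n, -u_+ / b_s)` is orthogonal to the tangent space. -/
def dualCriticalPoints {n : ℕ} (X : Set (ProjSpace (Fin (n + 1)))) (u : Fin (n + 1) → ℂ) :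
    Set (ProjSpace (Fin (n + 2))) :=
  {b | b ∈ regularPoints (dualVariety (sumEmbedding X)) ∧ (∀ i, b.rep i ≠ 0) ∧
    ∀ v ∈ tangentSpace (dualVariety (sumEmbedding X)) b,
      ∑ i, extData u i / b.rep i * v i = 0}

/-- The homogeneous polynomials `g_1, …, g_l` define the irreducible variety `Y`: their zero set
is `Y` (as an equality of affine cones) and the scheme that they define is generically reduced,
i.e. `(g_1, …, g_l)` and the ideal of `Y` agree after localization at the generic point of `Y`. -/
structure DefinesVariety {σ : Type} {l : ℕ} (g : Fin l → MvPolynomial σ ℂ)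
    (Y : Set (ProjSpace σ)) : Prop where
  homogeneous : ∀ j, ∃ d, (g j).IsHomogeneous d
  zeros : {v : σ → ℂ | ∀ j, eval v (g j) = 0} = affineCone Y
  genericallyReduced :
    ∃ h, h ∉ homIdeal Y ∧ ∀ f ∈ homIdeal Y, h * f ∈ Ideal.span (Set.range g)

/-- The ideal generated by the `k × k` minors of a matrix. -/
def minorsIdeal {R : Type} [CommRing R] {a b : ℕ} (k : ℕ) (M : Matrix (Fin a) (Fin b) R) :
    Ideal R :=
  Ideal.span {d | ∃ (r : Fin k ↪o Fin a) (s : Fin k ↪o Fin b), d = (M.submatrix r s).det}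

/-- The saturation `I : J^∞ = ⋃ N, (I : J ^ N)` (an increasing union of ideals). -/
def saturation {R : Type} [CommRing R] (I J : Ideal R) : Ideal R :=
  ⨆ N : ℕ, Submodule.colon I ((J ^ N : Ideal R) : Set R)

/-- The substitution `q_i ↦ b_i + b_s`. -/
def shift (n : ℕ) : MvPolynomial (Fin (n + 1)) ℂ →ₐ[ℂ] MvPolynomial (Fin (n + 2)) ℂ :=
  aeval (fun i => X i.castSucc + X (Fin.last (n + 1)))

/-- The Jacobian matrix `(∂ g_j / ∂ q_i)` evaluated at `(b_0 + b_s, …, b_n + b_s)`. -/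
def shiftedJacobian {n l : ℕ} (g : Fin l → MvPolynomial (Fin (n + 1)) ℂ) :
    Matrix (Fin l) (Fin (n + 1)) (MvPolynomial (Fin (n + 2)) ℂ) :=
  Matrix.of fun j i => shift n (pderiv i (g j))

/-- The product of the evaluated Jacobian, extended by the top row `(u_0 / b_0, …, u_n / b_n)`,
with the diagonal matrix `diag(b_0, …, b_n)`. Its entries are polynomials: those of the top row
are `u_0, …, u_n`. -/
def extendedJacobian {n l : ℕ} (g : Fin l → MvPolynomial (Fin (n + 1)) ℂ)
    (u : Fin (n + 1) → ℂ) :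
    Matrix (Fin (l + 1)) (Fin (n + 1)) (MvPolynomial (Fin (n + 2)) ℂ) :=
  Matrix.of (Matrix.vecCons (fun i => C (u i))
    (shiftedJacobian g * Matrix.diagonal fun i : Fin (n + 1) => X i.castSucc))

/-- The ideal of the dual likelihood equations. -/
def dualLikelihoodIdeal {n l : ℕ} (g : Fin l → MvPolynomial (Fin (n + 1)) ℂ) (c : ℕ)
    (u : Fin (n + 1) → ℂ) : Ideal (MvPolynomial (Fin (n + 2)) ℂ) :=
  saturation
    (Ideal.span (Set.range fun j => shift n (g j)) ⊔ minorsIdeal (c + 1) (extendedJacobian g u))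
    (Ideal.span {∏ i : Fin (n + 2), X i} * minorsIdeal c (shiftedJacobian g))

end DualMLE

end

open MvPolynomial

noncomputable section

namespace DualMLE

/-! ### Derivations, Krull dimension and transcendence degree. -/

open KaehlerDifferential TensorProduct

/-! Everything is moved to affine cones and to the generic point `(p, q)` of the conormal cone,
which lives in a field of transcendence degree equal to the number of coordinates (`ConormalField`).

Reflexivity is the first pillar (`rename_swap_mem_conormalIdeal_iff`). Every derivation `D` of that
field satisfies `∑ q_i D p_i = 0`; differentiating `∑ p_i q_i = 0` gives `∑ p_i D q_i = 0`. In
characteristic zero each tangent vector of the dual variety at `q` is the velocity of some `D`, so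
`p` is normal to the dual variety at `q`. This is one inclusion of prime ideals, and equality of
dimensions makes it an equality.

Next, `b` is conormal to `X'` at `(p, ∑ p_i)` exactly when `(b_i + b_s)` is conormal to `X` at `p`
(`mem_conormalCone_sumEmbedding`). By reflexivity this says that `p` is normal to `X^*` at `(b_i +
b_s)`. Where the coordinates of `b` and some minor in `S` are nonzero, the equations of `I_u` say
that `p = (u_i / b_i)` is in the row space of `J`, hence normal to `X^*`. Euler's relation then
supplies the remaining equation `p_s b_s = -u_+`.

The last pillar is genericity (`exists_generic_ne_zero`). The pairs `(u, b)` with `u_i = p_i b_i`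
form a family of dimension at most `n + 2`, and rescaling `b` preserves it. A hypersurface `f(b) =
0` not containing the dual cone cuts the dimension, and its fibres over `u` with `b ≠ 0` still
contain a scaling direction, so it misses a generic `u`. The argument covers the closure of the
family, where the zeros of the saturation lie; hence for generic `u` no zero of `W_u` lies on the
locus that was saturated away. The same argument, applied to a Jacobian minor of `X'^*`, gives
regularity; reflexivity for `X'` then identifies the critical points. -/

theorem exists_derivation_extension {k R L : Type} [CommRing k] [CommRing R] [Field L]
    [Algebra k R] [Algebra R L] [Algebra k L] [IsScalarTower k R L] [Algebra.FormallySmooth R L]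
    (D : Derivation k R L) :
    ∃ D' : Derivation k L L, ∀ r, D' (algebraMap R L r) = D r := by
  -- Formal smoothness kills the first cotangent homology, so differentials of `R` inject after base
  -- change to `L`; over a field the injection splits, and the splitting extends `D`.
  have hinj : Function.Injective (mapBaseChange k R L) := by
    rw [injective_iff_map_eq_zero]
    intro x hx
    obtain ⟨x, rfl⟩ := (Algebra.H1Cotangent.exact_δ_mapBaseChange k R L x).mp hx
    rw [Subsingleton.elim x 0, map_zero]
  obtain ⟨g, hg⟩ := (mapBaseChange k R L).exists_leftInverse_of_injective
    (LinearMap.ker_eq_bot.2 hinj)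
  let φ : L ⊗[R] Ω[R⁄k] →ₗ[L] L := D.liftKaehlerDifferential.liftBaseChange L
  refine ⟨(φ ∘ₗ g).compDer (KaehlerDifferential.D k L), fun r => ?_⟩
  have h1 : KaehlerDifferential.D k L (algebraMap R L r)
      = mapBaseChange k R L (1 ⊗ₜ KaehlerDifferential.D k R r) := by
    simp
  have h2 := LinearMap.congr_fun hg (1 ⊗ₜ KaehlerDifferential.D k R r)
  simp only [LinearMap.comp_apply, LinearMap.id_apply] at h2
  change φ (g (KaehlerDifferential.D k L (algebraMap R L r))) = _
  rw [h1, h2]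
  simp [φ]

/-- A localization followed by an algebraic extension in characteristic zero, which is separable;
both are formally étale. -/
theorem formallyEtale_of_isAlgebraic {R K : Type} [CommRing R] [IsDomain R] [Field K] [Algebra R K]
    [FaithfulSMul R K] [Algebra.IsAlgebraic R K] [CharZero R] : Algebra.FormallyEtale R K := by
  let : Algebra (FractionRing R) K := FractionRing.liftAlgebra R K
  have : IsScalarTower R (FractionRing R) K := inferInstance
  have : Algebra.FormallyEtale R (FractionRing R) :=
    Algebra.FormallyEtale.of_isLocalization (nonZeroDivisors R)
  have : CharZero (FractionRing R) :=
    charZero_of_injective_algebraMap (IsFractionRing.injective R (FractionRing R))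
  have : Algebra.IsAlgebraic (FractionRing R) K :=
    (IsFractionRing.comap_isAlgebraic_iff (A := R) (K := FractionRing R) (C := K)).1 inferInstance
  have : Algebra.FormallyEtale (FractionRing R) K := Algebra.FormallyEtale.of_isSeparable _ _
  exact Algebra.FormallyEtale.comp R (FractionRing R) K

/-- `K` is formally étale over the polynomial ring on a transcendence basis, so the differentials of
the basis elements form a basis of `Ω[K⁄ℂ]`. -/
theorem finrank_derivation {K ι : Type} [Field K] [Algebra ℂ K] [Finite ι] {x : ι → K}
    (hx : IsTranscendenceBasis ℂ x) :
    Module.finrank K (Derivation ℂ K K) = Nat.card ι := by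
  let : Algebra (MvPolynomial ι ℂ) K := (aeval x).toAlgebra
  have : IsScalarTower ℂ (MvPolynomial ι ℂ) K :=
    IsScalarTower.of_algebraMap_eq fun c => by
      change _ = aeval x _
      simp [MvPolynomial.algebraMap_eq]
  have : FaithfulSMul (MvPolynomial ι ℂ) K :=
    (faithfulSMul_iff_algebraMap_injective _ _).2 hx.1
  have : Algebra.IsAlgebraic (MvPolynomial ι ℂ) K := by
    have := hx.isAlgebraic
    refine ⟨fun y => ?_⟩
    obtain ⟨p, hp, hpy⟩ := this.isAlgebraic y
    refine ⟨p.map (hx.1.aevalEquiv.symm : _ →+* MvPolynomial ι ℂ), ?_, ?_⟩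
    · rwa [Ne, Polynomial.map_eq_zero_iff hx.1.aevalEquiv.symm.injective]
    · rw [Polynomial.aeval_def, Polynomial.eval₂_map, ← hpy, Polynomial.aeval_def]
      congr 1
      ext z
      change aeval x (hx.1.aevalEquiv.symm z) = _
      rw [← AlgebraicIndependent.algebraMap_aevalEquiv hx.1, AlgEquiv.apply_symm_apply]
  have : CharZero (MvPolynomial ι ℂ) := inferInstance
  have := formallyEtale_of_isAlgebraic (R := MvPolynomial ι ℂ) (K := K)
  have := Fintype.ofFinite ι
  let b : Module.Basis ι K (Ω[K⁄ℂ]) :=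
    (((mvPolynomialBasis ℂ ι).baseChange K)).map
      (tensorKaehlerEquivOfFormallyEtale ℂ (MvPolynomial ι ℂ) K)
  have : Module.Finite K (Ω[K⁄ℂ]) := Module.Finite.of_basis b
  rw [← (linearMapEquivDerivation ℂ K (M := K)).finrank_eq, Module.finrank_linearMap_self,
    Module.finrank_eq_nat_card_basis b]

/-- Incomparability bounds the dimension of `S` from above; going up lifts chains of primes of `R`
and bounds it from below. -/
theorem ringKrullDim_of_integral {R S : Type} [CommRing R] [CommRing S] [Algebra R S]
    [FaithfulSMul R S] [Algebra.IsIntegral R S] : ringKrullDim S = ringKrullDim R := by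
  apply le_antisymm
  · refine Order.krullDim_le_of_strictMono (PrimeSpectrum.comap (algebraMap R S)) ?_
    intro P Q hPQ
    exact Ideal.IsIntegral.comap_lt_comap (R := R) hPQ
  · refine iSup_le fun l => ?_
    obtain ⟨P, hP, hl⟩ := Ideal.exists_ideal_over_prime_of_isIntegral (S := S) l.head.asIdeal ⊥ (by
      intro x hx
      have : x = 0 := by
        have h : algebraMap R S x = 0 := hx
        exact (FaithfulSMul.algebraMap_injective R S) (by simpa using h)
      simp [this])
    obtain ⟨hP1, hP2⟩ := hl
    have : P.LiesOver l.head.asIdeal := ⟨hP2.symm⟩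
    obtain ⟨M, hM, -⟩ := Ideal.exists_ltSeries_of_hasGoingUp l P
    rw [← hM]
    exact le_iSup (fun p : LTSeries (PrimeSpectrum S) => ((p.length : ℕ) : WithBot ℕ∞)) M

/-- The Krull dimension of a finitely generated domain is its transcendence degree. -/
theorem exists_isTranscendenceBasis_ringKrullDim {A K : Type} [CommRing A] [IsDomain A] [Algebra ℂ A]
    [Algebra.FiniteType ℂ A] [Field K] [Algebra A K] [IsFractionRing A K] [Algebra ℂ K]
    [IsScalarTower ℂ A K] :
    ∃ (d : ℕ) (x : Fin d → K), IsTranscendenceBasis ℂ x ∧ ringKrullDim A = d := by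
  obtain ⟨d, g, hg, hint⟩ := exists_integral_inj_algHom_of_fg ℂ A
  let : Algebra (MvPolynomial (Fin d) ℂ) A := g.toAlgebra
  have : IsScalarTower ℂ (MvPolynomial (Fin d) ℂ) A :=
    IsScalarTower.of_algebraMap_eq fun c => (g.commutes c).symm
  have : FaithfulSMul (MvPolynomial (Fin d) ℂ) A :=
    (faithfulSMul_iff_algebraMap_injective _ _).2 hg
  have : Algebra.IsIntegral (MvPolynomial (Fin d) ℂ) A := ⟨hint⟩
  have hb : IsTranscendenceBasis ℂ (algebraMap (MvPolynomial (Fin d) ℂ) A ∘ X) :=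
    (IsTranscendenceBasis.mvPolynomial (Fin d) ℂ).algebraMap_comp
  refine ⟨d, algebraMap A K ∘ (algebraMap (MvPolynomial (Fin d) ℂ) A ∘ X), ?_, ?_⟩
  · have : Algebra.IsAlgebraic A K :=
      (IsFractionRing.comap_isAlgebraic_iff (A := A) (K := K) (C := K)).2 inferInstance
    exact hb.algebraMap_comp
  · rw [ringKrullDim_of_integral (R := MvPolynomial (Fin d) ℂ),
      MvPolynomial.ringKrullDim_of_isNoetherianRing]
    simp

/-- If `#ι` is at least the transcendence degree, then the elements `w i` and `φ ≠ 0` satisfy a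
polynomial relation that stays nontrivial when `φ` is replaced by `0`. -/
theorem exists_relation_coeff_zero_ne {L ι : Type} [Field L] [Algebra ℂ L] [Finite ι]
    (hι : Algebra.trdeg ℂ L ≤ Nat.card ι) (w : ι → L) {φ : L} (hφ : φ ≠ 0) :
    ∃ G : Polynomial (MvPolynomial ι ℂ), G.coeff 0 ≠ 0 ∧
      G.eval₂ (aeval w : MvPolynomial ι ℂ →ₐ[ℂ] L).toRingHom φ = 0 := by
  have hdep : ¬ AlgebraicIndependent ℂ (fun o : Option ι => o.elim φ w) := by
    intro h
    have h1 := h.cardinalMk_le_trdeg.trans hι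
    rw [← Nat.cast_card (α := Option ι), Nat.cast_le, Finite.card_option] at h1
    omega
  rw [algebraicIndependent_iff] at hdep
  push Not at hdep
  obtain ⟨H, hH, hH0⟩ := hdep
  let H' : Polynomial (MvPolynomial ι ℂ) := optionEquivLeft ℂ ι H
  have hH' : H' ≠ 0 := by simpa [H'] using hH0
  have heval : H'.eval₂ (aeval w : MvPolynomial ι ℂ →ₐ[ℂ] L).toRingHom φ = 0 := by
    rw [← hH]
    have : ((Polynomial.eval₂AlgHom (aeval w : MvPolynomial ι ℂ →ₐ[ℂ] L) φ
        (fun _ => Commute.all _ _)).comp (optionEquivLeft ℂ ι).toAlgHom) =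
        aeval (fun o : Option ι => o.elim φ w) := by
      ext o
      cases o <;> simp [optionEquivLeft_apply]
    exact DFunLike.congr_fun this H
  -- All powers of the variable standing for `φ` are divided out of the relation; this is harmless
  -- as `φ ≠ 0`.
  obtain ⟨G, hG⟩ := Polynomial.exists_eq_pow_rootMultiplicity_mul_and_not_dvd H' hH' 0
  refine ⟨G, ?_, ?_⟩
  · intro h
    exact hG.2 (by simpa using (Polynomial.X_dvd_iff.2 h))
  · rw [hG.1, Polynomial.eval₂_mul, Polynomial.eval₂_pow] at heval
    simpa [hφ] using heval

/-! ### Linear algebra: minors, Cramer's rule, orthogonal complements. -/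

/-- Linearly independent rows have a nonzero maximal minor. -/
theorem exists_det_ne_zero {K σ : Type} [Field K] [Finite σ] {r : ℕ} (v : Fin r → σ → K)
    (hv : LinearIndependent K v) :
    ∃ s : Fin r → σ, (Matrix.of fun j k => v j (s k)).det ≠ 0 := by
  have := Fintype.ofFinite σ
  obtain ⟨κ, a, ha, hspan, hlin⟩ := exists_linearIndependent' K (fun i : σ => fun j => v j i)
  have hrank : Module.finrank K (Submodule.span K (Set.range fun i : σ => fun j => v j i)) = r := by
    have h1 := Matrix.rank_eq_finrank_span_cols (Matrix.of v)
    have h2 : (Matrix.of v).rank = r := by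
      simpa using LinearIndependent.rank_matrix (M := Matrix.of v) hv
    exact h1.symm.trans h2
  have : Finite κ := Finite.of_injective a ha
  have := Fintype.ofFinite κ
  have hcard : Fintype.card κ = r := by
    rw [← hrank, ← hspan, finrank_span_eq_card hlin]
  let e : Fin r ≃ κ := (Fintype.equivFinOfCardEq hcard).symm
  refine ⟨a ∘ e, ?_⟩
  rw [← isUnit_iff_ne_zero, ← Matrix.isUnit_iff_isUnit_det,
    ← Matrix.linearIndependent_cols_iff_isUnit]
  exact hlin.comp e e.injective

theorem exists_orderEmbedding_equiv {a k : ℕ} (f : Fin k → Fin a) (hf : Function.Injective f) :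
    ∃ (g : Fin k ↪o Fin a) (e : Fin k ≃ Fin k), f = g ∘ e := by
  classical
  have hc : (Finset.univ.image f).card = k := by
    rw [Finset.card_image_of_injective _ hf]; simp
  let g := (Finset.univ.image f).orderEmbOfFin hc
  have hg : Set.range g = Set.range f := by
    simp [g]
  have h : ∀ i, ∃ j, g j = f i := fun i => by
    have : f i ∈ Set.range g := hg ▸ Set.mem_range_self i
    exact this
  choose e he using h
  have hinj : Function.Injective e := fun i j hij => hf (by rw [← he, ← he, hij])
  refine ⟨g, Equiv.ofBijective e (Finite.injective_iff_bijective.1 hinj), ?_⟩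
  ext i
  simp [he]

/-- A nonzero minor may be taken with increasing rows and columns. -/
theorem exists_orderEmbedding_det_ne_zero {R : Type} [CommRing R] {a b k : ℕ}
    (M : Matrix (Fin a) (Fin b) R) (r : Fin k → Fin a) (s : Fin k → Fin b) (Z : Ideal R)
    (h : (M.submatrix r s).det ∉ Z) :
    ∃ (r' : Fin k ↪o Fin a) (s' : Fin k ↪o Fin b), (M.submatrix r' s').det ∉ Z := by
  have hr : Function.Injective r := by
    intro i j hij
    by_contra hne
    exact h (by rw [Matrix.det_zero_of_row_eq hne (by ext; simp [hij])]; exact Z.zero_mem)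
  have hs : Function.Injective s := by
    intro i j hij
    by_contra hne
    exact h (by rw [Matrix.det_zero_of_column_eq hne (by simp [hij])]; exact Z.zero_mem)
  obtain ⟨r', e, rfl⟩ := exists_orderEmbedding_equiv r hr
  obtain ⟨s', e', rfl⟩ := exists_orderEmbedding_equiv s hs
  refine ⟨r', s', fun hZ => h ?_⟩
  have h1 : M.submatrix (r' ∘ e) (s' ∘ e')
      = (((M.submatrix r' s').submatrix e id).submatrix id e') := rfl
  rw [h1, Matrix.det_permute', Matrix.det_permute]
  exact Z.mul_mem_left _ (Z.mul_mem_left _ hZ)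

/-- Cramer's rule for a combination of the rows of a rectangular matrix. -/
theorem cramer_rows {R σ : Type} [CommRing R] {r : ℕ} (M : Fin r → σ → R) (s : Fin r → σ)
    (v : σ → R) (c : Fin r → R) (hv : v = fun i => ∑ j, c j * M j i) (i : σ) :
    (Matrix.of fun j k => M j (s k)).det * v i =
      ∑ j, (∑ k, v (s k) * (Matrix.of fun j k => M j (s k)).adjugate k j) * M j i := by
  set A : Matrix (Fin r) (Fin r) R := Matrix.of fun j k => M j (s k)
  -- On the columns `s` the combination is `c * A`, and the adjugate recovers `A.det • c` without
  -- division.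
  have h : Matrix.vecMul (fun k => v (s k)) A.adjugate = A.det • c := by
    have : (fun k => v (s k)) = Matrix.vecMul c A := by
      ext k
      simp [hv, A, Matrix.vecMul, dotProduct]
    rw [this, Matrix.vecMul_vecMul, Matrix.mul_adjugate]
    simp [Matrix.vecMul_smul]
  have h' : ∀ j, (∑ k, v (s k) * A.adjugate k j) = A.det * c j := fun j => congr_fun h j
  simp_rw [h', hv, Finset.mul_sum, mul_assoc]

theorem det_eq_zero_of_mem_submodule {K σ : Type} [Field K] [Finite σ] {c : ℕ}
    (W : Submodule K (σ → K)) (hW : Module.finrank K W ≤ c) (v : Fin (c + 1) → σ → K)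
    (hv : ∀ j, v j ∈ W) (s : Fin (c + 1) → σ) :
    (Matrix.of fun j k => v j (s k)).det = 0 := by
  by_contra hdet
  rw [← Ne, ← isUnit_iff_ne_zero, ← Matrix.isUnit_iff_isUnit_det,
    ← Matrix.linearIndependent_rows_iff_isUnit] at hdet
  have h1 : LinearIndependent K v := by
    refine LinearIndependent.of_comp (LinearMap.funLeft K K s) ?_
    exact hdet
  have h2 : LinearIndependent K (fun j => (⟨v j, hv j⟩ : W)) :=
    LinearIndependent.of_comp W.subtype h1
  have := h2.fintype_card_le_finrank
  simp at this
  omega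

section Perp

variable {K σ : Type} [Field K] [Fintype σ]

/-- The orthogonal complement for the standard dot product. -/
def perp (W : Submodule K (σ → K)) : Submodule K (σ → K) :=
  LinearMap.BilinForm.orthogonal (dotProductBilin K K) W

theorem mem_perp {W : Submodule K (σ → K)} {v : σ → K} :
    v ∈ perp W ↔ ∀ w ∈ W, ∑ i, w i * v i = 0 := Iff.rfl

theorem dotProductBilin_nondegenerate :
    LinearMap.BilinForm.Nondegenerate (dotProductBilin K K : LinearMap.BilinForm K (σ → K)) := by
  classical
  constructor
  · intro v hv
    ext i
    simpa using hv (Pi.single i 1)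
  · intro v hv
    ext i
    simpa using hv (Pi.single i 1)

theorem perp_perp (W : Submodule K (σ → K)) : perp (perp W) = W :=
  LinearMap.BilinForm.orthogonal_orthogonal dotProductBilin_nondegenerate
    (fun v w h => by
      simp only [dotProductBilin_apply_apply] at h ⊢
      rwa [dotProduct_comm]) W

theorem finrank_perp (W : Submodule K (σ → K)) :
    Module.finrank K W + Module.finrank K (perp W) = Fintype.card σ := by
  have h := LinearMap.BilinForm.finrank_orthogonal
    (B := (dotProductBilin K K : LinearMap.BilinForm K (σ → K))) dotProductBilin_nondegenerate W
  have h2 := Submodule.finrank_le W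
  rw [perp, h]
  rw [Module.finrank_fintype_fun_eq_card] at *
  omega

end Perp

/-! ### Gradients and normal spaces. -/

section Gradient

variable {σ E : Type} [CommRing E] [Algebra ℂ E]

/-- The gradient of a polynomial at a point with coordinates in a `ℂ`-algebra. -/
def gradient (y : σ → E) (f : MvPolynomial σ ℂ) : σ → E := fun i => aeval y (pderiv i f)

/-- The span of the gradients at `y` of the elements of `I`. -/
def normalSpan (I : Set (MvPolynomial σ ℂ)) (y : σ → E) : Submodule E (σ → E) :=
  Submodule.span E (gradient y '' I)

theorem mem_normalSpan_iff {I : Set (MvPolynomial σ ℂ)} {y z : σ → E} :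
    z ∈ normalSpan I y ↔ ∃ (n : ℕ) (c : Fin n → E) (h : Fin n → MvPolynomial σ ℂ),
      (∀ j, h j ∈ I) ∧ z = fun i => ∑ j, c j * gradient y (h j) i := by
  rw [normalSpan, Submodule.mem_span_set']
  constructor
  · rintro ⟨n, c, g, rfl⟩
    choose h hI hg using fun j => (g j).2
    refine ⟨n, c, h, hI, ?_⟩
    ext i
    simp [hg]
  · rintro ⟨n, c, h, hI, rfl⟩
    refine ⟨n, c, fun j => ⟨gradient y (h j), h j, hI j, rfl⟩, ?_⟩
    ext i
    simp

theorem gradient_mem_normalSpan {I : Set (MvPolynomial σ ℂ)} (y : σ → E) {f : MvPolynomial σ ℂ}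
    (hf : f ∈ I) : gradient y f ∈ normalSpan I y :=
  Submodule.subset_span ⟨f, hf, rfl⟩

theorem gradient_mul (y : σ → E) (f g : MvPolynomial σ ℂ) :
    gradient y (f * g) = aeval y f • gradient y g + aeval y g • gradient y f := by
  ext i
  simp [gradient]

/-- The chain rule. -/
theorem derivation_aeval [Fintype σ] {M : Type} [AddCommGroup M] [Module E M] [Module ℂ M]
    (D : Derivation ℂ E M) (y : σ → E) (f : MvPolynomial σ ℂ) :
    D (aeval y f) = ∑ i, gradient y f i • D (y i) := by
  classical
  induction f using MvPolynomial.induction_on with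
  | C a => simp [gradient, MvPolynomial.algHom_C]
  | add f g hf hg => simp [gradient, hf, hg, add_smul, Finset.sum_add_distrib] at *
  | mul_X f j hf =>
    rw [map_mul, D.leibniz, hf, aeval_X]
    simp only [gradient_mul, Pi.add_apply, Pi.smul_apply, add_smul, Finset.sum_add_distrib,
      smul_assoc, ← Finset.smul_sum, aeval_X]
    congr 2
    rw [Finset.sum_eq_single j]
    · simp [gradient]
    · intro i _ hi
      simp [gradient, pderiv_X_of_ne hi.symm]
    · simp

end Gradient

/-! ### The affine conormal cone. -/

section Cone

variable {σ : Type}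

/-- The pairs of a point of `V` and a combination of gradients of equations of `V` there. -/
def conormalCone (V : Set (σ → ℂ)) : Set (σ ⊕ σ → ℂ) :=
  {z | z ∘ Sum.inl ∈ V ∧
    z ∘ Sum.inr ∈ normalSpan (vanishingIdeal ℂ V : Set (MvPolynomial σ ℂ)) (z ∘ Sum.inl)}

def conormalIdeal (V : Set (σ → ℂ)) : Ideal (MvPolynomial (σ ⊕ σ) ℂ) :=
  vanishingIdeal ℂ (conormalCone V)

/-- Affine cones whose ideal is prime. -/
structure IsIrreducibleCone (V : Set (σ → ℂ)) : Prop where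
  zero_mem : 0 ∈ V
  smul_mem : ∀ (t : ℂ) (v : σ → ℂ), v ∈ V → t • v ∈ V
  prime : (vanishingIdeal ℂ V : Ideal (MvPolynomial σ ℂ)).IsPrime

theorem mem_conormalCone {V : Set (σ → ℂ)} {p q : σ → ℂ} :
    Sum.elim p q ∈ conormalCone V ↔
      p ∈ V ∧ q ∈ normalSpan (vanishingIdeal ℂ V : Set (MvPolynomial σ ℂ)) p := by
  simp [conormalCone]

/-- Elements of the conormal ideal vanish at all generalized conormal vectors. -/
theorem aeval_eq_zero_of_mem_conormalIdeal {V : Set (σ → ℂ)} {F : MvPolynomial (σ ⊕ σ) ℂ}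
    (hF : F ∈ conormalIdeal V) {E : Type} [CommRing E] [Algebra ℂ E] {y z : σ → E}
    (hy : ∀ f ∈ vanishingIdeal ℂ V, aeval y f = 0)
    (hz : z ∈ normalSpan (vanishingIdeal ℂ V : Set (MvPolynomial σ ℂ)) y) :
    aeval (Sum.elim y z) F = 0 := by
  obtain ⟨n, c, h, hI, rfl⟩ := mem_normalSpan_iff.1 hz
  -- The coefficients of the combination become indeterminates. For complex values of them `F`
  -- vanishes over `V`, so every coefficient of `Θ` lies in the ideal of `V` and therefore vanishes
  -- at `y`.
  let Θ : MvPolynomial (Fin n) (MvPolynomial σ ℂ) :=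
    aeval (Sum.elim (fun i => C (X i)) (fun i => ∑ j, X j * C (pderiv i (h j)))) F
  have hΘ : ∀ m, coeff m Θ ∈ vanishingIdeal ℂ V := by
    intro m
    rw [mem_vanishingIdeal_iff]
    intro v hv
    have h0 : map (aeval v : MvPolynomial σ ℂ →ₐ[ℂ] ℂ).toRingHom Θ = 0 := by
      refine MvPolynomial.funext fun t => ?_
      have h1 : (eval t).comp ((map (aeval v : MvPolynomial σ ℂ →ₐ[ℂ] ℂ).toRingHom).comp
          (aeval (Sum.elim (fun i => C (X i)) (fun i => ∑ j, X j * C (pderiv i (h j)))) :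
            MvPolynomial (σ ⊕ σ) ℂ →ₐ[ℂ] MvPolynomial (Fin n) (MvPolynomial σ ℂ)).toRingHom) =
          (aeval (Sum.elim v fun i => ∑ j, t j * gradient v (h j) i) :
            MvPolynomial (σ ⊕ σ) ℂ →ₐ[ℂ] ℂ).toRingHom := by
        refine MvPolynomial.ringHom_ext (fun a => ?_) fun i => ?_
        · simp [MvPolynomial.algebraMap_eq]
        · cases i <;> simp [gradient]
      rw [map_zero]
      refine (DFunLike.congr_fun h1 F).trans ?_
      exact mem_vanishingIdeal_iff.1 hF _ (mem_conormalCone.2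
        ⟨hv, mem_normalSpan_iff.2 ⟨n, t, h, hI, rfl⟩⟩)
    have := congrArg (coeff m) h0
    rw [coeff_map] at this
    simpa using this
  have h1 : (eval₂Hom (aeval y : MvPolynomial σ ℂ →ₐ[ℂ] E).toRingHom c).comp
      (aeval (Sum.elim (fun i => C (X i)) (fun i => ∑ j, X j * C (pderiv i (h j)))) :
        MvPolynomial (σ ⊕ σ) ℂ →ₐ[ℂ] MvPolynomial (Fin n) (MvPolynomial σ ℂ)).toRingHom =
      (aeval (Sum.elim y fun i => ∑ j, c j * gradient y (h j) i) :
        MvPolynomial (σ ⊕ σ) ℂ →ₐ[ℂ] E).toRingHom := by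
    refine MvPolynomial.ringHom_ext (fun a => ?_) fun i => ?_
    · simp [MvPolynomial.algebraMap_eq]
    · cases i <;> simp [gradient]
  refine (DFunLike.congr_fun h1 F).symm.trans ?_
  change eval₂ _ _ Θ = 0
  rw [eval₂_eq]
  exact Finset.sum_eq_zero fun m _ => by
    have := hy _ (hΘ m)
    simp [this]

end Cone

/-! ### Tangent vectors as derivations; the Jacobian criterion at the generic point. -/

section Generic

variable {σ : Type} [Fintype σ]

/-- A tangent vector at a point with coordinates in a finitely generated field extension of `ℂ`
is the velocity of a derivation. -/
theorem exists_derivation_of_tangent {L : Type} [Field L] [Algebra ℂ L] [Algebra.EssFiniteType ℂ L]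
    {I : Ideal (MvPolynomial σ ℂ)} {y : σ → L} (hI : RingHom.ker (aeval y : MvPolynomial σ ℂ →ₐ[ℂ] L) = I)
    {v : σ → L} (hv : v ∈ perp (normalSpan (I : Set (MvPolynomial σ ℂ)) y)) :
    ∃ D : Derivation ℂ L L, ∀ i, D (y i) = v i := by
  have hprime : I.IsPrime := hI ▸ RingHom.ker_isPrime _
  let A := MvPolynomial σ ℂ ⧸ I
  let φ : A →ₐ[ℂ] L := Ideal.Quotient.liftₐ I (aeval y) (fun f hf => by
    rw [← hI] at hf
    exact hf)
  have hφ : ∀ f, φ (Ideal.Quotient.mk I f) = aeval y f := fun f => rfl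
  have hφi : Function.Injective φ := by
    rw [injective_iff_map_eq_zero]
    intro a ha
    obtain ⟨f, rfl⟩ := Ideal.Quotient.mk_surjective a
    rw [hφ] at ha
    rw [Ideal.Quotient.eq_zero_iff_mem, ← hI]
    exact ha
  let _ : Algebra A L := φ.toAlgebra
  have : IsScalarTower ℂ A L := IsScalarTower.of_algebraMap_eq fun c => (φ.commutes c).symm
  have hf : FaithfulSMul A L := (faithfulSMul_iff_algebraMap_injective _ _).2 hφi
  let _ : Algebra (FractionRing A) L := FractionRing.liftAlgebra A L
  have : IsScalarTower A (FractionRing A) L := inferInstance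
  have : IsScalarTower ℂ (FractionRing A) L := by
    refine IsScalarTower.of_algebraMap_eq fun c => ?_
    rw [IsScalarTower.algebraMap_apply ℂ A (FractionRing A), ← IsScalarTower.algebraMap_apply A,
      ← IsScalarTower.algebraMap_apply]
  have : Algebra.EssFiniteType (FractionRing A) L := Algebra.EssFiniteType.of_comp ℂ _ _
  have : CharZero (FractionRing A) :=
    charZero_of_injective_algebraMap (algebraMap ℂ (FractionRing A)).injective
  -- A finitely generated field extension in characteristic zero is formally smooth; this is what
  -- lets derivations of `A` extend to `L`.
  have : Algebra.FormallySmooth (FractionRing A) L := inferInstance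
  have : Algebra.FormallySmooth A (FractionRing A) :=
    Algebra.FormallySmooth.of_isLocalization (nonZeroDivisors A)
  have : Algebra.FormallySmooth A L := Algebra.FormallySmooth.comp A (FractionRing A) L
  -- The derivative at `y` in the direction `v`. It kills `I` because `v` is orthogonal to the
  -- gradients, so it descends to a derivation of `A`.
  let S : MvPolynomial σ ℂ → L := fun f => ∑ i, gradient y f i * v i
  have hSadd : ∀ f g, S (f + g) = S f + S g := fun f g => by
    simp [S, gradient, add_mul, Finset.sum_add_distrib]
  have hSsub : ∀ f g, S (f - g) = S f - S g := fun f g => by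
    simp [S, gradient, sub_mul, Finset.sum_sub_distrib]
  have hSsmul : ∀ (c : ℂ) f, S (c • f) = c • S f := fun c f => by
    simp [S, gradient, Finset.smul_sum]
  have hSmul : ∀ f g, S (f * g) = aeval y f * S g + aeval y g * S f := fun f g => by
    simp [S, gradient_mul, add_mul, Finset.sum_add_distrib, Finset.mul_sum, mul_assoc]
  have hS0 : ∀ f ∈ I, S f = 0 := fun f hf => hv _ (gradient_mem_normalSpan y hf)
  have hSeq : ∀ f g, Ideal.Quotient.mk I f = Ideal.Quotient.mk I g → S f = S g := fun f g h => by
    rw [Ideal.Quotient.eq] at h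
    rw [← sub_eq_zero, ← hSsub]
    exact hS0 _ h
  let out : A → MvPolynomial σ ℂ := Function.surjInv Ideal.Quotient.mk_surjective
  have hout : ∀ a, Ideal.Quotient.mk I (out a) = a :=
    Function.surjInv_eq Ideal.Quotient.mk_surjective
  have houty : ∀ a, aeval y (out a) = algebraMap A L a := fun a => by
    conv_rhs => rw [← hout a]
    rfl
  let D₀ : Derivation ℂ A L := Derivation.mk'
    { toFun := fun a => S (out a)
      map_add' := fun a b => by
        rw [← hSadd]
        exact hSeq _ _ (by rw [map_add, hout, hout, hout])
      map_smul' := fun c a => by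
        rw [RingHom.id_apply, ← hSsmul]
        refine hSeq _ _ ?_
        rw [hout]
        conv_lhs => rw [← hout a]
        rfl }
    (fun a b => by
      simp only [LinearMap.coe_mk, AddHom.coe_mk]
      rw [Algebra.smul_def, Algebra.smul_def, ← houty, ← houty, ← hSmul]
      exact hSeq _ _ (by rw [map_mul, hout, hout, hout]))
  obtain ⟨D, hD⟩ := exists_derivation_extension D₀
  refine ⟨D, fun i => ?_⟩
  have h1 : y i = algebraMap A L (Ideal.Quotient.mk I (X i)) := by
    change _ = aeval y (X i)
    rw [aeval_X]
  rw [h1, hD]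
  change S (out _) = _
  rw [hSeq _ (X i) (hout _)]
  classical
  simp [S, gradient, pderiv_X, Pi.single_apply]

variable (I : Ideal (MvPolynomial σ ℂ)) [I.IsPrime]

/-- The function field of the variety of a prime ideal. -/
abbrev FunctionField : Type := FractionRing (MvPolynomial σ ℂ ⧸ I)

/-- The generic point of the variety of a prime ideal. -/
def genericPoint : σ → FunctionField I := fun i => algebraMap _ _ (Ideal.Quotient.mk I (X i))

theorem aeval_genericPoint {τ : Type} (J : Ideal (MvPolynomial τ ℂ)) (f : MvPolynomial τ ℂ) :
    aeval (genericPoint J) f = algebraMap _ (FunctionField J) (Ideal.Quotient.mk J f) := by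
  have : (aeval (genericPoint J) : MvPolynomial τ ℂ →ₐ[ℂ] FunctionField J) =
      (IsScalarTower.toAlgHom ℂ (MvPolynomial τ ℂ ⧸ J) (FunctionField J)).comp
        (Ideal.Quotient.mkₐ ℂ J) := by
    ext i
    simp [genericPoint]
  rw [this]
  rfl

theorem aeval_genericPoint_eq_zero {τ : Type} (J : Ideal (MvPolynomial τ ℂ))
    {f : MvPolynomial τ ℂ} : aeval (genericPoint J) f = 0 ↔ f ∈ J := by
  rw [aeval_genericPoint, ← Ideal.Quotient.eq_zero_iff_mem]
  exact map_eq_zero_iff _ (IsFractionRing.injective _ _)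

theorem ker_aeval_genericPoint {τ : Type} (J : Ideal (MvPolynomial τ ℂ)) :
    RingHom.ker (aeval (genericPoint J) : MvPolynomial τ ℂ →ₐ[ℂ] FunctionField J) = J := by
  ext f
  exact aeval_genericPoint_eq_zero J

instance : Algebra.EssFiniteType ℂ (FunctionField I) := inferInstance

/-- A derivation of the function field is determined by its values on the generic point, and the
vectors so obtained are exactly those orthogonal to the normal space. Thus the tangent space has the
dimension of the module of derivations, which is the transcendence degree. -/
theorem finrank_normalSpan_genericPoint :
    ∃ (d : ℕ) (t : Fin d → FunctionField I), IsTranscendenceBasis ℂ t ∧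
      ringKrullDim (MvPolynomial σ ℂ ⧸ I) = d ∧
      Module.finrank (FunctionField I) (normalSpan (I : Set (MvPolynomial σ ℂ)) (genericPoint I)) + d
        = Fintype.card σ := by
  obtain ⟨d, t, ht, hd⟩ := exists_isTranscendenceBasis_ringKrullDim
    (A := MvPolynomial σ ℂ ⧸ I) (K := FunctionField I)
  refine ⟨d, t, ht, hd, ?_⟩
  have hder := finrank_derivation ht
  rw [Nat.card_fin] at hder
  rw [← finrank_perp (normalSpan (I : Set (MvPolynomial σ ℂ)) (genericPoint I)), ← hder]
  congr 1
  let Φ : Derivation ℂ (FunctionField I) (FunctionField I) →ₗ[FunctionField I]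
      (σ → FunctionField I) :=
    { toFun := fun D i => D (genericPoint I i)
      map_add' := fun _ _ => rfl
      map_smul' := fun _ _ => rfl }
  have hinj : Function.Injective Φ := by
    rw [injective_iff_map_eq_zero]
    intro D hD
    have h0 : ∀ a : MvPolynomial σ ℂ ⧸ I, D (algebraMap _ _ a) = 0 := by
      intro a
      obtain ⟨f, rfl⟩ := Ideal.Quotient.mk_surjective a
      rw [← aeval_genericPoint, derivation_aeval]
      exact Finset.sum_eq_zero fun i _ => by
        have : D (genericPoint I i) = 0 := congr_fun hD i
        simp [this]
    ext z
    obtain ⟨a, b, hb, rfl⟩ := IsFractionRing.div_surjective (A := MvPolynomial σ ℂ ⧸ I) z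
    simp [Derivation.leibniz_div, h0]
  have hrange : LinearMap.range Φ = perp (normalSpan (I : Set (MvPolynomial σ ℂ)) (genericPoint I)) := by
    ext v
    constructor
    · rintro ⟨D, rfl⟩
      rw [mem_perp]
      intro w hw
      obtain ⟨n, c, h, hI, rfl⟩ := mem_normalSpan_iff.1 hw
      simp only [Finset.sum_mul]
      rw [Finset.sum_comm]
      refine Finset.sum_eq_zero fun j _ => ?_
      simp only [mul_assoc]
      rw [← Finset.mul_sum]
      have := derivation_aeval D (genericPoint I) (h j)
      rw [(aeval_genericPoint_eq_zero I).2 (hI j), D.map_zero] at this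
      simp only [smul_eq_mul] at this
      exact (congrArg (c j * ·) this.symm).trans (mul_zero _)
    · intro hv
      obtain ⟨D, hD⟩ := exists_derivation_of_tangent (ker_aeval_genericPoint I) hv
      exact ⟨D, funext hD⟩
  rw [← hrange, LinearMap.finrank_range_of_inj hinj]

end Generic

/-! ### The generic conormal vector. -/

section ConormalField

theorem normalSpan_map {σ E E' : Type} [CommRing E] [Algebra ℂ E] [CommRing E'] [Algebra ℂ E']
    (φ : E →ₐ[ℂ] E') {I : Set (MvPolynomial σ ℂ)} {y z : σ → E} (hz : z ∈ normalSpan I y) :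
    (fun i => φ (z i)) ∈ normalSpan I fun i => φ (y i) := by
  obtain ⟨n, c, h, hI, rfl⟩ := mem_normalSpan_iff.1 hz
  refine mem_normalSpan_iff.2 ⟨n, fun j => φ (c j), h, hI, ?_⟩
  ext i
  simp only [map_sum, map_mul, gradient]
  refine Finset.sum_congr rfl fun j _ => ?_
  rw [← comp_aeval_apply]

variable {σ : Type} [Fintype σ]

/-- A function field of the conormal variety of `V`, with its generic conormal vector. -/
structure ConormalField (V : Set (σ → ℂ)) where
  carrier : Type
  [field : Field carrier]
  [algebra : Algebra ℂ carrier]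
  essFiniteType : Algebra.EssFiniteType ℂ carrier
  p : σ → carrier
  q : σ → carrier
  ker_eq : RingHom.ker (aeval (Sum.elim p q) : MvPolynomial (σ ⊕ σ) ℂ →ₐ[ℂ] carrier) = conormalIdeal V
  ker_p_eq : RingHom.ker (aeval p : MvPolynomial σ ℂ →ₐ[ℂ] carrier) = vanishingIdeal ℂ V
  q_mem : q ∈ normalSpan (vanishingIdeal ℂ V : Set (MvPolynomial σ ℂ)) p
  trdeg_eq : Algebra.trdeg ℂ carrier = Fintype.card σ
  isAlgebraic : Algebra.IsAlgebraic (Algebra.adjoin ℂ (Set.range (Sum.elim p q))) carrier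

attribute [instance] ConormalField.field ConormalField.algebra ConormalField.essFiniteType

theorem isAlgebraic_adjoin_of_eq_top {L : Type} [Field L] [Algebra ℂ L] {s : Set L}
    (h : IntermediateField.adjoin ℂ s = ⊤) : Algebra.IsAlgebraic (Algebra.adjoin ℂ s) L := by
  refine ⟨fun z => ?_⟩
  have hz : z ∈ IntermediateField.adjoin ℂ s := h ▸ IntermediateField.mem_top
  obtain ⟨a, ha, b, hb, rfl⟩ := IntermediateField.mem_adjoin_iff_div.1 hz
  rw [div_eq_mul_inv]
  exact (isAlgebraic_algebraMap (⟨a, ha⟩ : Algebra.adjoin ℂ s)).mul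
    (isAlgebraic_algebraMap (⟨b, hb⟩ : Algebra.adjoin ℂ s)).inv

/-- The generic conormal vector is a combination, with independent indeterminates as coefficients,
of a basis of the normal space at the generic point `x`. The transcendence degree is then dimension
plus codimension. -/
theorem nonempty_conormalField {V : Set (σ → ℂ)} {K : Type} [Field K] [Algebra ℂ K]
    [Algebra.EssFiniteType ℂ K] {x : σ → K}
    (hx : ∀ f : MvPolynomial σ ℂ, aeval x f = 0 ↔ f ∈ vanishingIdeal ℂ V)
    (hgen : IntermediateField.adjoin ℂ (Set.range x) = ⊤) {d : ℕ} {t : Fin d → K}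
    (ht : IsTranscendenceBasis ℂ t)
    (hd : Module.finrank K (normalSpan (vanishingIdeal ℂ V : Set (MvPolynomial σ ℂ)) x) + d =
      Fintype.card σ) :
    Nonempty (ConormalField V) := by
  classical
  set I : Ideal (MvPolynomial σ ℂ) := vanishingIdeal ℂ V with hIdef
  set W := normalSpan (I : Set (MvPolynomial σ ℂ)) x with hW
  set r := Module.finrank K W with hr
  let b : Module.Basis (Fin r) K W := Module.finBasis K W
  let pM : σ → (MvPolynomial (Fin r) K) := fun i => C (x i)
  let qM : σ → (MvPolynomial (Fin r) K) := fun i => ∑ j, X j * C ((b j : σ → K) i)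
  let φ : (MvPolynomial (Fin r) K) →ₐ[ℂ] (FractionRing (MvPolynomial (Fin r) K)) :=
    IsScalarTower.toAlgHom ℂ (MvPolynomial (Fin r) K) (FractionRing (MvPolynomial (Fin r) K))
  have hφ : Function.Injective φ :=
    IsFractionRing.injective (MvPolynomial (Fin r) K) (FractionRing (MvPolynomial (Fin r) K))
  let p : σ → (FractionRing (MvPolynomial (Fin r) K)) := fun i => φ (pM i)
  let q : σ → (FractionRing (MvPolynomial (Fin r) K)) := fun i => φ (qM i)
  let ψ : K →ₐ[ℂ] (MvPolynomial (Fin r) K) := IsScalarTower.toAlgHom ℂ K (MvPolynomial (Fin r) K)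
  have hψ : ∀ a, ψ a = C a := fun a => rfl
  have hpaeval : ∀ f : MvPolynomial σ ℂ, aeval p f = φ (ψ (aeval x f)) := by
    intro f
    rw [comp_aeval_apply, comp_aeval_apply]
    rfl
  have hpI : ∀ f : MvPolynomial σ ℂ, aeval p f = 0 ↔ f ∈ I := by
    intro f
    rw [hpaeval, map_eq_zero_iff _ hφ, hψ, map_eq_zero_iff _ (C_injective (Fin r) K)]
    exact hx f
  have hq : q ∈ normalSpan (I : Set (MvPolynomial σ ℂ)) p := by
    have hq' : q = ∑ j, φ (X j) • fun i => φ (ψ ((b j : σ → K) i)) := by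
      ext i
      simp [q, qM, hψ]
    rw [hq']
    refine Submodule.sum_mem _ fun j _ => Submodule.smul_mem _ _ ?_
    exact normalSpan_map φ (normalSpan_map ψ (b j).2)
  have hpq : ∀ F : MvPolynomial (σ ⊕ σ) ℂ,
      aeval (Sum.elim p q) F = φ (aeval (Sum.elim pM qM) F) := by
    intro F
    rw [comp_aeval_apply]
    congr 2
    ext i
    cases i <;> rfl
  have hker : ∀ F : MvPolynomial (σ ⊕ σ) ℂ,
      aeval (Sum.elim p q) F = 0 ↔ F ∈ conormalIdeal V := by
    intro F
    constructor
    · intro hF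
      rw [hpq, map_eq_zero_iff _ hφ] at hF
      rw [conormalIdeal, mem_vanishingIdeal_iff]
      intro z hz
      obtain ⟨hv, hz'⟩ := hz
      obtain ⟨n, c, h, hI, hzc⟩ := mem_normalSpan_iff.1 hz'
      -- The combination of gradients at the given complex point is continued to all points, with
      -- the same constants `c k`. At `x` it is a specialization `ev` of the generic vector, so `F'`
      -- vanishes at `x` and hence on `V`.
      let F' : MvPolynomial σ ℂ :=
        aeval (Sum.elim X fun i => ∑ k, C (c k) * pderiv i (h k)) F
      let g : Fin n → W := fun k => ⟨gradient x (h k), gradient_mem_normalSpan x (hI k)⟩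
      let ev : (MvPolynomial (Fin r) K) →ₐ[ℂ] K :=
        (aeval (fun j => ∑ k, algebraMap ℂ K (c k) * b.repr (g k) j) :
          (MvPolynomial (Fin r) K) →ₐ[K] K).restrictScalars ℂ
      have h1 : aeval x F' = 0 := by
        have h2 : aeval x F' = ev (aeval (Sum.elim pM qM) F) := by
          rw [comp_aeval_apply, comp_aeval_apply]
          congr 2
          ext i
          rcases i with i | i
          · simp [ev, pM]
          · have hg : ∀ k, ∑ j, b.repr (g k) j * (b j : σ → K) i = gradient x (h k) i := by
              intro k
              have := congrArg (fun w : W => (w : σ → K) i) (b.sum_repr (g k))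
              simp only [Submodule.coe_sum, Submodule.coe_smul, Finset.sum_apply, Pi.smul_apply,
                smul_eq_mul] at this
              exact this
            simp only [Sum.elim_inr, map_sum, map_mul, qM, ev, AlgHom.restrictScalars_apply,
              aeval_X, aeval_C, Algebra.algebraMap_self, RingHom.id_apply, Finset.sum_mul]
            rw [Finset.sum_comm]
            refine Finset.sum_congr rfl fun k _ => ?_
            simp only [mul_assoc]
            rw [← Finset.mul_sum, hg]
            rfl
        rw [h2, hF, map_zero]
      have h3 : F' ∈ I := (hx _).1 h1
      have h4 := mem_vanishingIdeal_iff.1 h3 _ hv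
      rw [← h4, comp_aeval_apply]
      congr 2
      ext i
      rcases i with i | i
      · simp
      · have := congr_fun hzc i
        simp only [Function.comp_apply] at this
        simp [this, gradient, Function.comp_def]
    · intro hF
      exact aeval_eq_zero_of_mem_conormalIdeal hF (fun f hf => (hpI f).2 hf) hq
  have htrans : IsTranscendenceBasis K (algebraMap (MvPolynomial (Fin r) K)
      (FractionRing (MvPolynomial (Fin r) K)) ∘ X : Fin r → (FractionRing (MvPolynomial (Fin r) K))) := by
    have : Algebra.IsAlgebraic (MvPolynomial (Fin r) K) (FractionRing (MvPolynomial (Fin r) K)) :=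
      (IsFractionRing.comap_isAlgebraic_iff (A := (MvPolynomial (Fin r) K))
        (K := (FractionRing (MvPolynomial (Fin r) K))) (C := (FractionRing (MvPolynomial (Fin r) K)))).2 inferInstance
    exact (IsTranscendenceBasis.mvPolynomial (Fin r) K).algebraMap_comp
  have htr := (ht.sumElim_comp htrans).lift_cardinalMk_eq_trdeg
  refine ⟨⟨(FractionRing (MvPolynomial (Fin r) K)), ?_, p, q, ?_, ?_, hq, ?_, ?_⟩⟩
  · have : Algebra.EssFiniteType K (MvPolynomial (Fin r) K) := inferInstance
    have : Algebra.EssFiniteType ℂ (MvPolynomial (Fin r) K) :=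
      Algebra.EssFiniteType.comp ℂ K (MvPolynomial (Fin r) K)
    infer_instance
  · ext F
    exact hker F
  · ext f
    exact hpI f
  · simp only [Cardinal.lift_id] at htr
    rw [← htr, ← Nat.cast_card, Nat.card_eq_fintype_card]
    simp [← hd]
  · apply isAlgebraic_adjoin_of_eq_top
    set E := IntermediateField.adjoin ℂ (Set.range (Sum.elim p q)) with hE
    have hp : ∀ i, p i ∈ E := fun i => IntermediateField.subset_adjoin _ _ ⟨Sum.inl i, rfl⟩
    have hq' : ∀ i, q i ∈ E := fun i => IntermediateField.subset_adjoin _ _ ⟨Sum.inr i, rfl⟩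
    have hK : ∀ a : K, φ (ψ a) ∈ E := by
      intro a
      have ha : a ∈ IntermediateField.adjoin ℂ (Set.range x) := hgen ▸ IntermediateField.mem_top
      have hle : IntermediateField.adjoin ℂ (Set.range x) ≤ E.comap (φ.comp ψ) := by
        rw [IntermediateField.adjoin_le_iff]
        rintro _ ⟨i, rfl⟩
        exact hp i
      exact hle ha
    have hXE : ∀ j, φ (X j) ∈ E := by
      intro j
      obtain ⟨g, hg⟩ := W.subtype.exists_leftInverse_of_injective (by simp)
      -- A functional dual to the `j`-th basis vector reads the indeterminate `X j` off the
      -- coordinates of `q`; so the coordinates of `p` and `q` generate the field.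
      let α : (σ → K) →ₗ[K] K := b.coord j ∘ₗ g
      have hα : ∀ k, α (b k) = if k = j then 1 else 0 := by
        intro k
        have : g (b k) = b k := LinearMap.congr_fun hg (b k)
        simp [α, this, Finsupp.single_apply]
      have hsum : ∀ k, ∑ i, (b k : σ → K) i * α (Pi.single i 1) = if k = j then 1 else 0 := by
        intro k
        rw [← hα k]
        conv_rhs => rw [LinearMap.pi_apply_eq_sum_univ α]
        simp only [smul_eq_mul]
        refine Finset.sum_congr rfl fun i _ => ?_
        congr 2
        ext i'
        simp [Pi.single_apply, eq_comm]
      have : φ (X j) = ∑ i, φ (ψ (α (Pi.single i 1))) * q i := by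
        simp only [q, ← map_mul, ← map_sum]
        congr 1
        simp only [qM, Finset.mul_sum, hψ]
        rw [Finset.sum_comm]
        have h1 : ∀ k, ∑ i, C (α (Pi.single i 1)) * (X k * C ((b k : σ → K) i)) =
            (X k * C (if k = j then 1 else 0) : (MvPolynomial (Fin r) K)) := by
          intro k
          rw [← hsum k, map_sum, Finset.mul_sum]
          refine Finset.sum_congr rfl fun i _ => ?_
          rw [map_mul]
          ring
        rw [Finset.sum_congr rfl fun k _ => h1 k, Finset.sum_eq_single j]
        · simp
        · intro k _ hk
          simp [hk]
        · simp
      rw [this]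
      exact E.sum_mem fun i _ => E.mul_mem (hK _) (hq' i)
    have hM : ∀ m : (MvPolynomial (Fin r) K), φ m ∈ E := by
      intro m
      induction m using MvPolynomial.induction_on with
      | C a => exact hK a
      | add f g hf hg => rw [map_add]; exact E.add_mem hf hg
      | mul_X f i hf => rw [map_mul]; exact E.mul_mem hf (hXE i)
    rw [eq_top_iff]
    intro z _
    obtain ⟨a, c, hc, rfl⟩ := IsFractionRing.div_surjective (A := (MvPolynomial (Fin r) K)) z
    exact E.div_mem (hM a) (hM c)

theorem adjoin_range_genericPoint {τ : Type} (I : Ideal (MvPolynomial τ ℂ)) [I.IsPrime] :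
    IntermediateField.adjoin ℂ (Set.range (genericPoint I)) = ⊤ := by
  set E := IntermediateField.adjoin ℂ (Set.range (genericPoint I))
  have haeval : ∀ f : MvPolynomial τ ℂ, aeval (genericPoint I) f ∈ E := by
    intro f
    induction f using MvPolynomial.induction_on with
    | C a => rw [aeval_C]; exact E.algebraMap_mem a
    | add f g hf hg => rw [map_add]; exact E.add_mem hf hg
    | mul_X f i hf =>
      rw [map_mul, aeval_X]
      exact E.mul_mem hf (IntermediateField.subset_adjoin _ _ ⟨i, rfl⟩)
  rw [eq_top_iff]
  intro a _
  obtain ⟨f, g, hg, rfl⟩ := IsFractionRing.div_surjective (A := MvPolynomial τ ℂ ⧸ I) a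
  obtain ⟨f, rfl⟩ := Ideal.Quotient.mk_surjective f
  obtain ⟨g, rfl⟩ := Ideal.Quotient.mk_surjective g
  rw [← aeval_genericPoint, ← aeval_genericPoint]
  exact E.div_mem (haeval f) (haeval g)

theorem exists_conormalField {V : Set (σ → ℂ)} (hV : IsIrreducibleCone V) :
    Nonempty (ConormalField V) := by
  have hprime := hV.prime
  obtain ⟨d, t, ht, -, hd⟩ :=
    finrank_normalSpan_genericPoint (vanishingIdeal ℂ V : Ideal (MvPolynomial σ ℂ))
  have h1 : ∀ f : MvPolynomial σ ℂ, aeval (genericPoint (vanishingIdeal ℂ V)) f = 0 ↔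
      f ∈ vanishingIdeal ℂ V := fun f => aeval_genericPoint_eq_zero _
  exact nonempty_conormalField h1 (adjoin_range_genericPoint _) ht hd

end ConormalField

/-! ### Reflexivity of conormal varieties. -/

section Reflexivity

variable {σ : Type} [Fintype σ]

/-- Euler's relation for the equations of a cone. -/
theorem IsIrreducibleCone.sum_X_mul_pderiv_mem {V : Set (σ → ℂ)} (hV : IsIrreducibleCone V)
    {f : MvPolynomial σ ℂ} (hf : f ∈ vanishingIdeal ℂ V) :
    ∑ i, X i * pderiv i f ∈ vanishingIdeal ℂ V := by
  rw [mem_vanishingIdeal_iff]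
  intro v hv
  -- `f` need not be homogeneous: its restriction to the line through `v` is the zero polynomial,
  -- and Euler's expression is the derivative of that restriction at `1`.
  let y : σ → Polynomial ℂ := fun i => Polynomial.X * Polynomial.C (v i)
  have h0 : aeval y f = 0 := by
    refine Polynomial.funext fun t => ?_
    have h1 : (Polynomial.aeval t).comp (aeval y : MvPolynomial σ ℂ →ₐ[ℂ] Polynomial ℂ) =
        aeval (t • v) := by
      ext i
      simp [y]
      ring
    have h2 := DFunLike.congr_fun h1 f
    rw [mem_vanishingIdeal_iff.1 hf _ (hV.smul_mem t v hv)] at h2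
    simpa using h2
  have h3 := derivation_aeval (Polynomial.derivative' (R := ℂ)) y f
  rw [h0, Derivation.map_zero] at h3
  have h4 := congrArg (Polynomial.aeval (1 : ℂ)) h3
  simp only [map_zero, map_sum, smul_eq_mul, map_mul, gradient] at h4
  rw [map_sum, h4]
  refine Finset.sum_congr rfl fun i _ => ?_
  have h5 : ∀ i, Polynomial.aeval (1 : ℂ) (y i) = v i := fun i => by simp [y]
  have h6 : Polynomial.aeval (1 : ℂ) (Polynomial.derivative' (y i)) = v i := by
    change Polynomial.aeval (1 : ℂ) (Polynomial.derivative (y i)) = v i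
    simp [y]
  rw [comp_aeval_apply, h6, map_mul, aeval_X, mul_comm]
  simp only [h5]

namespace ConormalField

variable {V : Set (σ → ℂ)} (c : ConormalField V)

theorem aeval_eq_zero {F : MvPolynomial (σ ⊕ σ) ℂ} :
    aeval (Sum.elim c.p c.q) F = 0 ↔ F ∈ conormalIdeal V := by
  rw [← c.ker_eq]
  rfl

theorem aeval_p_eq_zero {f : MvPolynomial σ ℂ} : aeval c.p f = 0 ↔ f ∈ vanishingIdeal ℂ V := by
  rw [← c.ker_p_eq]
  rfl

/-- `q` combines gradients of equations satisfied by `p`, and `D` annihilates each of these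
equations. -/
theorem sum_q_mul_derivation (D : Derivation ℂ c.carrier c.carrier) :
    ∑ i, c.q i * D (c.p i) = 0 := by
  obtain ⟨n, a, h, hI, hq⟩ := mem_normalSpan_iff.1 c.q_mem
  rw [hq]
  simp only [Finset.sum_mul]
  rw [Finset.sum_comm]
  refine Finset.sum_eq_zero fun j _ => ?_
  simp only [mul_assoc]
  rw [← Finset.mul_sum]
  have := derivation_aeval D c.p (h j)
  rw [c.aeval_p_eq_zero.2 (hI j), D.map_zero] at this
  simp only [smul_eq_mul] at this
  rw [← this, mul_zero]

theorem sum_p_mul_q (hV : IsIrreducibleCone V) : ∑ i, c.p i * c.q i = 0 := by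
  obtain ⟨n, a, h, hI, hq⟩ := mem_normalSpan_iff.1 c.q_mem
  rw [hq]
  simp only [Finset.mul_sum]
  rw [Finset.sum_comm]
  refine Finset.sum_eq_zero fun j _ => ?_
  have := c.aeval_p_eq_zero.2 (hV.sum_X_mul_pderiv_mem (hI j))
  simp only [map_sum, map_mul, aeval_X] at this
  calc ∑ i, c.p i * (a j * gradient c.p (h j) i)
      = a j * ∑ i, c.p i * aeval c.p (pderiv i (h j)) := by
        rw [Finset.mul_sum]
        exact Finset.sum_congr rfl fun i _ => by rw [gradient]; ring
    _ = 0 := by rw [this, mul_zero]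

theorem sum_p_mul_derivation (hV : IsIrreducibleCone V) (D : Derivation ℂ c.carrier c.carrier) :
    ∑ i, c.p i * D (c.q i) = 0 := by
  have h1 := congrArg D (c.sum_p_mul_q hV)
  simp only [map_sum, D.leibniz, smul_eq_mul, Finset.sum_add_distrib, map_zero,
    c.sum_q_mul_derivation D, add_zero] at h1
  exact h1

variable {V' : Set (σ → ℂ)}

/-- By double orthogonality it is enough to test against tangent vectors of the dual variety at `q`;
each is the velocity of a derivation, to which `sum_p_mul_derivation` applies. -/
theorem p_mem_normalSpan (hV : IsIrreducibleCone V)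
    (hdual : vanishingIdeal ℂ V' =
      (conormalIdeal V).comap (rename Sum.inr : MvPolynomial σ ℂ →ₐ[ℂ] _)) :
    c.p ∈ normalSpan (vanishingIdeal ℂ V' : Set (MvPolynomial σ ℂ)) c.q := by
  have hker : RingHom.ker (aeval c.q : MvPolynomial σ ℂ →ₐ[ℂ] c.carrier) = vanishingIdeal ℂ V' := by
    ext f
    rw [hdual, Ideal.mem_comap, ← c.aeval_eq_zero, aeval_rename]
    rfl
  rw [← perp_perp (normalSpan _ _), mem_perp]
  intro v hv
  obtain ⟨D, hD⟩ := exists_derivation_of_tangent hker hv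
  rw [← c.sum_p_mul_derivation hV D]
  exact Finset.sum_congr rfl fun i _ => by rw [hD, mul_comm]

theorem q_vanishing
    (hdual : vanishingIdeal ℂ V' =
      (conormalIdeal V).comap (rename Sum.inr : MvPolynomial σ ℂ →ₐ[ℂ] _)) {f : MvPolynomial σ ℂ} :
    aeval c.q f = 0 ↔ f ∈ vanishingIdeal ℂ V' := by
  rw [hdual, Ideal.mem_comap, ← c.aeval_eq_zero, aeval_rename]
  rfl

end ConormalField

/-- Reflexivity of conormal varieties. -/
theorem rename_swap_mem_conormalIdeal_iff {V V' : Set (σ → ℂ)} (hV : IsIrreducibleCone V)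
    (hV' : IsIrreducibleCone V')
    (hdual : vanishingIdeal ℂ V' =
      (conormalIdeal V).comap (rename Sum.inr : MvPolynomial σ ℂ →ₐ[ℂ] _))
    (F : MvPolynomial (σ ⊕ σ) ℂ) :
    rename Sum.swap F ∈ conormalIdeal V' ↔ F ∈ conormalIdeal V := by
  obtain ⟨c⟩ := exists_conormalField hV
  obtain ⟨c'⟩ := exists_conormalField hV'
  have hle : ∀ F, rename Sum.swap F ∈ conormalIdeal V' → F ∈ conormalIdeal V := by
    intro F hF
    have := aeval_eq_zero_of_mem_conormalIdeal hF
      (fun f hf => (c.q_vanishing hdual).2 hf) (c.p_mem_normalSpan hV hdual)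
    rw [aeval_rename] at this
    rw [← c.aeval_eq_zero, ← this]
    congr 2
    ext i
    cases i <;> rfl
  refine ⟨hle F, fun hF => ?_⟩
  by_contra hF'
  rw [← c'.aeval_eq_zero, aeval_rename] at hF'
  set y : σ ⊕ σ → c'.carrier := Sum.elim c'.p c'.q ∘ Sum.swap with hy
  have halg := c.isAlgebraic
  -- Strict inclusion of the prime ideals would contradict equality of dimensions. To see it, a
  -- transcendence basis is chosen among the coordinates of the conormal pair of `V`; the same
  -- coordinates and the nonzero value of `F` are dependent on the side of `V'`.
  obtain ⟨t, ht, hbasis⟩ := exists_isTranscendenceBasis_subset (R := ℂ) (A := c.carrier)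
    (Set.range (Sum.elim c.p c.q))
  choose idx hidx using fun a : t => ht a.2
  have hcard := hbasis.cardinalMk_eq_trdeg
  rw [c.trdeg_eq] at hcard
  have hfin : Finite t := Cardinal.lt_aleph0_iff_finite.1 (hcard ▸ Cardinal.natCast_lt_aleph0)
  have hle' : Algebra.trdeg ℂ c'.carrier ≤ Nat.card t := by
    rw [c'.trdeg_eq, ← hcard, Nat.cast_card]
  obtain ⟨G, hG0, hG⟩ := exists_relation_coeff_zero_ne hle' (fun a => y (idx a)) hF'
  let Γ : MvPolynomial (σ ⊕ σ) ℂ :=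
    G.eval₂ (aeval fun a => X (idx a) : MvPolynomial t ℂ →ₐ[ℂ] MvPolynomial (σ ⊕ σ) ℂ).toRingHom F
  have hΓ : ∀ {L : Type} [Field L] [Algebra ℂ L] (z : σ ⊕ σ → L), aeval z Γ =
      G.eval₂ (aeval fun a => z (idx a) : MvPolynomial t ℂ →ₐ[ℂ] L).toRingHom (aeval z F) := by
    intro L _ _ z
    have h1 := Polynomial.hom_eval₂ G
      (aeval fun a => X (idx a) : MvPolynomial t ℂ →ₐ[ℂ] MvPolynomial (σ ⊕ σ) ℂ).toRingHom
      (aeval z : MvPolynomial (σ ⊕ σ) ℂ →ₐ[ℂ] L).toRingHom F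
    refine h1.trans ?_
    congr 1
    refine MvPolynomial.ringHom_ext (fun a => ?_) fun i => ?_
    · simp [MvPolynomial.algebraMap_eq]
    · simp
  have h1 : Γ ∈ conormalIdeal V := by
    apply hle
    rw [← c'.aeval_eq_zero, aeval_rename, hΓ]
    exact hG
  -- On the side of `V` the value of `F` is zero, so only the constant coefficient of the relation
  -- survives: a nontrivial relation among algebraically independent elements.
  rw [← c.aeval_eq_zero, hΓ, c.aeval_eq_zero.2 hF, Polynomial.eval₂_at_zero] at h1
  apply hG0
  have h2 : Function.Injective (aeval (fun a : t => (a : c.carrier)) : MvPolynomial t ℂ →ₐ[ℂ] _) :=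
    hbasis.1
  apply h2
  rw [map_zero, ← h1]
  congr 2
  ext a
  exact (hidx a).symm

end Reflexivity

/-! ### Normal spaces where a Jacobian minor does not vanish. -/

section Minors

variable {σ ι : Type}

/-- A minor of the Jacobian matrix of a family of polynomials. -/
def jacobianMinor (f : ι → MvPolynomial σ ℂ) {r : ℕ} (a : Fin r → ι) (s : Fin r → σ) :
    MvPolynomial σ ℂ :=
  (Matrix.of fun j k => pderiv (s k) (f (a j))).det

theorem aeval_jacobianMinor {E : Type} [CommRing E] [Algebra ℂ E] (f : ι → MvPolynomial σ ℂ) {r : ℕ}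
    (a : Fin r → ι) (s : Fin r → σ) (y : σ → E) :
    aeval y (jacobianMinor f a s) = (Matrix.of fun j k => gradient y (f (a j)) (s k)).det := by
  rw [jacobianMinor, AlgHom.map_det]
  rfl

/-- The expression of Cramer's rule for the `i`-th coordinate of a vector with coordinates the
left variables, in terms of the gradients at the right variables. -/
def cramerRelation (f : ι → MvPolynomial σ ℂ) {r : ℕ} (a : Fin r → ι) (s : Fin r → σ) (i : σ) :
    MvPolynomial (σ ⊕ σ) ℂ :=
  rename Sum.inr (jacobianMinor f a s) * X (Sum.inl i) -
    ∑ j, (∑ k, X (Sum.inl (s k)) * rename Sum.inr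
      ((Matrix.of fun j k => pderiv (s k) (f (a j))).adjugate k j)) *
        rename Sum.inr (pderiv i (f (a j)))

theorem aeval_cramerRelation {E : Type} [CommRing E] [Algebra ℂ E] (f : ι → MvPolynomial σ ℂ) {r : ℕ}
    (a : Fin r → ι) (s : Fin r → σ) (i : σ) (z y : σ → E) :
    aeval (Sum.elim z y) (cramerRelation f a s i) =
      (Matrix.of fun j k => gradient y (f (a j)) (s k)).det * z i -
        ∑ j, (∑ k, z (s k) * (Matrix.of fun j k => gradient y (f (a j)) (s k)).adjugate k j) *
          gradient y (f (a j)) i := by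
  have h : ∀ g : MvPolynomial σ ℂ,
      aeval (Sum.elim z y) (rename Sum.inr g : MvPolynomial (σ ⊕ σ) ℂ) = aeval y g :=
    fun g => by rw [aeval_rename]; rfl
  have hadj : ∀ k j, aeval y ((Matrix.of fun j k => pderiv (s k) (f (a j))).adjugate k j) =
      (Matrix.of fun j k => gradient y (f (a j)) (s k)).adjugate k j := by
    intro k j
    have := congrFun (congrFun (AlgHom.map_adjugate (aeval y : MvPolynomial σ ℂ →ₐ[ℂ] E)
      (Matrix.of fun j k => pderiv (s k) (f (a j)))) k) j
    exact this
  simp only [cramerRelation, map_sub, map_mul, map_sum, h, hadj, aeval_X, Sum.elim_inl,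
    aeval_jacobianMinor]
  rfl

theorem aeval_cramerRelation_eq_zero {E : Type} [CommRing E] [Algebra ℂ E]
    (f : ι → MvPolynomial σ ℂ) {r : ℕ} (a : Fin r → ι) (s : Fin r → σ) (i : σ) {z y : σ → E}
    (hz : z ∈ Submodule.span E (Set.range fun j => gradient y (f (a j)))) :
    aeval (Sum.elim z y) (cramerRelation f a s i) = 0 := by
  obtain ⟨c, rfl⟩ := (Submodule.mem_span_range_iff_exists_fun E).1 hz
  rw [aeval_cramerRelation, sub_eq_zero]
  refine cramer_rows (fun j => gradient y (f (a j))) s _ c ?_ i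
  ext i
  simp

/-- Where the minor is invertible, Cramer's rule gives the coefficients. With
`aeval_cramerRelation_eq_zero` this makes membership in the span a polynomial condition, which
passes from generic points to all points of a closure. -/
theorem mem_span_of_aeval_cramerRelation {E : Type} [Field E] [Algebra ℂ E]
    (f : ι → MvPolynomial σ ℂ) {r : ℕ} (a : Fin r → ι) (s : Fin r → σ) {z y : σ → E}
    (h0 : aeval y (jacobianMinor f a s) ≠ 0)
    (hz : ∀ i, aeval (Sum.elim z y) (cramerRelation f a s i) = 0) :
    z ∈ Submodule.span E (Set.range fun j => gradient y (f (a j))) := by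
  rw [Submodule.mem_span_range_iff_exists_fun]
  rw [aeval_jacobianMinor] at h0
  set d := (Matrix.of fun j k => gradient y (f (a j)) (s k)).det with hd
  refine ⟨fun j => d⁻¹ * ∑ k, z (s k) *
    (Matrix.of fun j k => gradient y (f (a j)) (s k)).adjugate k j, ?_⟩
  ext i
  have h1 := hz i
  rw [aeval_cramerRelation, sub_eq_zero] at h1
  have h2 : z i = d⁻¹ * (d * z i) := by field_simp
  rw [h2, h1, Finset.mul_sum]
  simp [mul_assoc]

theorem linearIndependent_of_aeval_jacobianMinor {E : Type} [Field E] [Algebra ℂ E]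
    (f : ι → MvPolynomial σ ℂ) {r : ℕ} (a : Fin r → ι) (s : Fin r → σ) {y : σ → E}
    (h0 : aeval y (jacobianMinor f a s) ≠ 0) :
    LinearIndependent E fun j => gradient y (f (a j)) := by
  rw [aeval_jacobianMinor, ← isUnit_iff_ne_zero, ← Matrix.isUnit_iff_isUnit_det,
    ← Matrix.linearIndependent_rows_iff_isUnit] at h0
  exact LinearIndependent.of_comp (LinearMap.funLeft E E s) h0

variable [Fintype σ]

/-- A family of elements of a prime ideal whose gradients span the normal space at the generic
point has a minor of the size of the codimension that is nonzero at the generic point, and the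
gradients of its rows span the normal space wherever it does not vanish. -/
theorem exists_jacobianMinor (I : Ideal (MvPolynomial σ ℂ)) [I.IsPrime] (f : ι → MvPolynomial σ ℂ)
    (hfI : ∀ j, f j ∈ I)
    (hspan : ∀ h ∈ I, gradient (genericPoint I) h ∈
      Submodule.span (FunctionField I) (Set.range fun j => gradient (genericPoint I) (f j))) :
    ∃ (r : ℕ) (a : Fin r → ι) (s : Fin r → σ),
      ringKrullDim (MvPolynomial σ ℂ ⧸ I) + (r : WithBot ℕ∞) = (Fintype.card σ : WithBot ℕ∞) ∧
      jacobianMinor f a s ∉ I ∧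
      ∀ (E : Type) [Field E] [Algebra ℂ E] (y : σ → E), (∀ h ∈ I, aeval y h = 0) →
        aeval y (jacobianMinor f a s) ≠ 0 → normalSpan (I : Set (MvPolynomial σ ℂ)) y =
          Submodule.span E (Set.range fun j => gradient y (f (a j))) := by
  obtain ⟨d, -, -, hdim, hd⟩ := finrank_normalSpan_genericPoint I
  obtain ⟨κ, a₀, ha₀, hs, hlin⟩ := exists_linearIndependent' (FunctionField I)
    (fun j => gradient (genericPoint I) (f j))
  have hnormal : normalSpan (I : Set (MvPolynomial σ ℂ)) (genericPoint I) =
      Submodule.span (FunctionField I) (Set.range fun j => gradient (genericPoint I) (f j)) := by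
    apply le_antisymm
    · rw [normalSpan, Submodule.span_le]
      rintro _ ⟨h, hh, rfl⟩
      exact hspan h hh
    · rw [Submodule.span_le]
      rintro _ ⟨j, rfl⟩
      exact gradient_mem_normalSpan _ (hfI j)
  have hfin : Finite κ := hlin.finite
  have := Fintype.ofFinite κ
  have hcard : Fintype.card κ =
      Module.finrank (FunctionField I) (normalSpan (I : Set (MvPolynomial σ ℂ)) (genericPoint I)) := by
    rw [hnormal, ← hs, finrank_span_eq_card hlin]
  obtain ⟨r, hr⟩ : ∃ r, Fintype.card κ = r := ⟨_, rfl⟩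
  let e : Fin r ≃ κ := (Fintype.equivFinOfCardEq hr).symm
  have hlin' := hlin.comp e e.injective
  obtain ⟨s, hdet⟩ := exists_det_ne_zero _ hlin'
  have hs' : normalSpan (I : Set (MvPolynomial σ ℂ)) (genericPoint I) =
      Submodule.span (FunctionField I)
        (Set.range fun j => gradient (genericPoint I) (f (a₀ (e j)))) := by
    rw [hnormal, ← hs]
    congr 1
    exact (e.surjective.range_comp
      ((fun j => gradient (genericPoint I) (f j)) ∘ a₀)).symm
  refine ⟨r, a₀ ∘ e, s, ?_, ?_, ?_⟩
  · rw [hdim, ← hd, ← hcard, hr, add_comm]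
    norm_cast
  · rw [← aeval_genericPoint_eq_zero, aeval_jacobianMinor]
    exact hdet
  · intro E _ _ y hy h0
    apply le_antisymm
    · rw [normalSpan, Submodule.span_le]
      rintro _ ⟨h, hh, rfl⟩
      refine mem_span_of_aeval_cramerRelation f _ s h0 fun i => ?_
      -- Cramer's relation for the vector `∇h`, as a polynomial in the point. It vanishes at the
      -- generic point, so it lies in `I` and vanishes at `y` too.
      let R : MvPolynomial σ ℂ :=
        aeval (Sum.elim (fun i => pderiv i h) X) (cramerRelation f (a₀ ∘ e) s i)
      have hR : ∀ {E' : Type} [CommRing E'] [Algebra ℂ E'] (y' : σ → E'), aeval y' R =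
          aeval (Sum.elim (gradient y' h) y') (cramerRelation f (a₀ ∘ e) s i) := by
        intro E' _ _ y'
        rw [comp_aeval_apply]
        congr 2
        ext i
        cases i <;> simp [gradient]
      rw [← hR]
      apply hy
      rw [← aeval_genericPoint_eq_zero, hR]
      apply aeval_cramerRelation_eq_zero
      have := gradient_mem_normalSpan (genericPoint I) hh
      rw [hs'] at this
      exact this
    · rw [Submodule.span_le]
      rintro _ ⟨j, rfl⟩
      exact gradient_mem_normalSpan _ (hfI _)

/-- At a conormal pair `(p, q)` with a nonzero minor at `q`, the vector `p` is normal to the dual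
variety. -/
theorem mem_span_of_mem_zeroLocus_conormalIdeal {V V' : Set (σ → ℂ)} (hV : IsIrreducibleCone V)
    (hdual : vanishingIdeal ℂ V' =
      (conormalIdeal V).comap (rename Sum.inr : MvPolynomial σ ℂ →ₐ[ℂ] _))
    {f : ι → MvPolynomial σ ℂ} {r : ℕ} {a : Fin r → ι} {s : Fin r → σ}
    (hminor : jacobianMinor f a s ∉ vanishingIdeal ℂ V')
    (hspan : ∀ (E : Type) [Field E] [Algebra ℂ E] (y : σ → E),
      (∀ h ∈ vanishingIdeal ℂ V', aeval y h = 0) → aeval y (jacobianMinor f a s) ≠ 0 →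
        normalSpan (vanishingIdeal ℂ V' : Set (MvPolynomial σ ℂ)) y =
          Submodule.span E (Set.range fun j => gradient y (f (a j))))
    {p q : σ → ℂ} (hpq : ∀ F ∈ conormalIdeal V, aeval (Sum.elim p q) F = 0)
    (hq : aeval q (jacobianMinor f a s) ≠ 0) :
    p ∈ Submodule.span ℂ (Set.range fun j => gradient q (f (a j))) := by
  obtain ⟨c⟩ := exists_conormalField hV
  refine mem_span_of_aeval_cramerRelation f a s hq fun i => hpq _ ?_
  rw [← c.aeval_eq_zero]
  apply aeval_cramerRelation_eq_zero
  rw [← hspan _ c.q (fun h hh => (c.q_vanishing hdual).2 hh)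
    (fun h => hminor ((c.q_vanishing hdual).1 h))]
  exact c.p_mem_normalSpan hV hdual

end Minors

/-! ### Homogeneous components and scaling. -/

section Scaling

variable {τ : Type}

theorem aeval_scale_of_isWeightedHomogeneous {E : Type} [CommRing E] [Algebra ℂ E] {w : τ → ℕ}
    {F : MvPolynomial τ ℂ} {d : ℕ} (hF : F.IsWeightedHomogeneous w d) (t : E) (z : τ → E) :
    aeval (fun i => t ^ w i * z i) F = t ^ d * aeval z F := by
  rw [aeval_def, aeval_def, eval₂_eq, eval₂_eq, Finset.mul_sum]
  refine Finset.sum_congr rfl fun m hm => ?_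
  have hw := hF (mem_support_iff.1 hm)
  rw [Finsupp.weight_apply, Finsupp.sum] at hw
  simp only [mul_pow, Finset.prod_mul_distrib, ← pow_mul]
  rw [Finset.prod_pow_eq_pow_sum, ← hw]
  have : ∑ i ∈ m.support, w i * m i = ∑ i ∈ m.support, m i • w i :=
    Finset.sum_congr rfl fun i _ => by rw [smul_eq_mul, mul_comm]
  rw [this]
  ring

theorem sum_weightedHomogeneousComponent_eq (w : τ → ℕ) (F : MvPolynomial τ ℂ) :
    ∃ s : Finset ℕ, F = ∑ d ∈ s, weightedHomogeneousComponent w d F :=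
  ⟨_, by
    conv_lhs => rw [← sum_weightedHomogeneousComponent w F,
      finsum_eq_sum _ (weightedHomogeneousComponent_finsupp F)]⟩

/-- The ideal of a set that is stable under a weighted scaling is stable under taking weighted
homogeneous components. -/
theorem weightedHomogeneousComponent_mem_vanishingIdeal {w : τ → ℕ} {Z : Set (τ → ℂ)}
    (hZ : ∀ t : ℂ, t ≠ 0 → ∀ z ∈ Z, (fun i => t ^ w i * z i) ∈ Z) {F : MvPolynomial τ ℂ}
    (hF : F ∈ vanishingIdeal ℂ Z) (d : ℕ) :
    weightedHomogeneousComponent w d F ∈ vanishingIdeal ℂ Z := by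
  rw [mem_vanishingIdeal_iff]
  intro z hz
  obtain ⟨s, hs⟩ := sum_weightedHomogeneousComponent_eq w F
  by_cases hd : d ∈ s
  swap
  · classical
    have : weightedHomogeneousComponent w d F = 0 := by
      ext m
      rw [coeff_weightedHomogeneousComponent, coeff_zero, ite_eq_right_iff]
      intro hm
      rw [hs, coeff_sum]
      refine Finset.sum_eq_zero fun e he => ?_
      rw [coeff_weightedHomogeneousComponent, if_neg]
      rintro rfl
      exact hd (hm ▸ he)
    rw [this, map_zero]
  -- The value of `F` along the orbit of `z`, as a polynomial in the scaling parameter. It vanishes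
  -- at all nonzero parameters, so each coefficient, which is the value of one component, is zero.
  let P : Polynomial ℂ :=
    ∑ e ∈ s, Polynomial.C (aeval z (weightedHomogeneousComponent w e F)) * Polynomial.X ^ e
  have hP : P = 0 := by
    refine Polynomial.eq_zero_of_infinite_isRoot _ ?_
    refine Set.Infinite.mono (s := {0}ᶜ) ?_ (Set.finite_singleton (0 : ℂ)).infinite_compl
    intro t ht
    have h1 := mem_vanishingIdeal_iff.1 hF _ (hZ t ht z hz)
    rw [hs, map_sum] at h1
    simp only [aeval_scale_of_isWeightedHomogeneous
      (weightedHomogeneousComponent_isWeightedHomogeneous _ F)] at h1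
    simp only [P, Set.mem_ofPred_eq, Polynomial.IsRoot, Polynomial.eval_finsetSum,
      Polynomial.eval_mul, Polynomial.eval_C, Polynomial.eval_pow, Polynomial.eval_X]
    rw [← h1]
    exact Finset.sum_congr rfl fun e _ => mul_comm _ _
  have h2 := congrArg (fun Q => Polynomial.coeff Q d) hP
  simp only [P, Polynomial.finsetSum_coeff, Polynomial.coeff_C_mul, Polynomial.coeff_X_pow,
    Polynomial.coeff_zero] at h2
  rw [Finset.sum_eq_single d] at h2
  · simpa using h2
  · intro e _ he
    simp [he.symm]
  · intro h
    exact absurd hd h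

theorem isWeightedHomogeneous_weightedHomogeneousComponent {w w' : τ → ℕ} {F : MvPolynomial τ ℂ}
    {d e : ℕ} (hF : F.IsWeightedHomogeneous w d) :
    (weightedHomogeneousComponent w' e F).IsWeightedHomogeneous w d := by
  classical
  intro m hm
  rw [coeff_weightedHomogeneousComponent] at hm
  exact hF (fun h => hm (by simp [h]))

variable {ι : Type}

theorem isHomogeneous_jacobianMinor {f : ι → MvPolynomial τ ℂ} (hf : ∀ j, ∃ d, (f j).IsHomogeneous d)
    {r : ℕ} (a : Fin r → ι) (s : Fin r → τ) : ∃ d, (jacobianMinor f a s).IsHomogeneous d := by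
  choose d hd using hf
  refine ⟨∑ j, (d (a j) - 1), ?_⟩
  rw [jacobianMinor, Matrix.det_apply]
  refine IsHomogeneous.sum _ _ _ fun π _ => ?_
  have h1 : (∏ i, (Matrix.of fun j k => pderiv (s k) (f (a j))) (π i) i).IsHomogeneous
      (∑ i, (d (a (π i)) - 1)) :=
    IsHomogeneous.prod _ _ _ fun i _ => (hd (a (π i))).pderiv
  rw [Equiv.sum_comp π (fun j => d (a j) - 1)] at h1
  rw [Units.smul_def, zsmul_eq_mul]
  have h2 : ((π.sign : ℤ) : MvPolynomial τ ℂ) = C ((π.sign : ℤ) : ℂ) := by simp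
  rw [h2]
  exact h1.C_mul _

theorem gradient_sum {E : Type} [CommRing E] [Algebra ℂ E] (y : τ → E) {s : Finset ℕ}
    (F : ℕ → MvPolynomial τ ℂ) : gradient y (∑ d ∈ s, F d) = ∑ d ∈ s, gradient y (F d) := by
  ext i
  simp [gradient]

/-- The gradients of the homogeneous elements of the ideal of a cone span the normal space. -/
theorem IsIrreducibleCone.gradient_mem_span_homogeneous {V : Set (τ → ℂ)} (hV : IsIrreducibleCone V)
    {E : Type} [CommRing E] [Algebra ℂ E] (y : τ → E) {h : MvPolynomial τ ℂ}
    (hh : h ∈ vanishingIdeal ℂ V) :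
    gradient y h ∈ Submodule.span E (Set.range fun f : {f : MvPolynomial τ ℂ //
      f ∈ vanishingIdeal ℂ V ∧ ∃ d, f.IsHomogeneous d} => gradient y f.1) := by
  obtain ⟨s, hs⟩ := sum_weightedHomogeneousComponent_eq (1 : τ → ℕ) h
  rw [hs, gradient_sum]
  refine Submodule.sum_mem _ fun d _ => Submodule.subset_span ⟨⟨_, ?_, d, ?_⟩, rfl⟩
  · refine weightedHomogeneousComponent_mem_vanishingIdeal (fun t _ z hz => ?_) hh d
    simp only [Pi.one_apply, pow_one]
    exact hV.smul_mem t z hz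
  · exact weightedHomogeneousComponent_isWeightedHomogeneous d h

end Scaling

section ConormalScaling

variable {σ : Type}

/-- The normal spaces of a cone are constant along rays. -/
theorem IsIrreducibleCone.normalSpan_smul {V : Set (σ → ℂ)} (hV : IsIrreducibleCone V) {t : ℂ}
    {v z : σ → ℂ} (hz : z ∈ normalSpan (vanishingIdeal ℂ V : Set (MvPolynomial σ ℂ)) v)
    (ht : t ≠ 0) :
    z ∈ normalSpan (vanishingIdeal ℂ V : Set (MvPolynomial σ ℂ)) (t • v) := by
  have hle : normalSpan (vanishingIdeal ℂ V : Set (MvPolynomial σ ℂ)) v ≤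
      Submodule.span ℂ (Set.range fun f : {f : MvPolynomial σ ℂ //
        f ∈ vanishingIdeal ℂ V ∧ ∃ d, f.IsHomogeneous d} => gradient v f.1) := by
    rw [normalSpan, Submodule.span_le]
    rintro _ ⟨h, hh, rfl⟩
    exact hV.gradient_mem_span_homogeneous v hh
  refine (Submodule.span_le.2 ?_) (hle hz)
  rintro _ ⟨⟨f, hf, d, hd⟩, rfl⟩
  -- For `d = 0` the truncated exponent is harmless, because the gradient is zero.
  have h1 : gradient (t • v) f = t ^ (d - 1) • gradient v f := by
    ext i
    have := aeval_scale_of_isWeightedHomogeneous (hd.pderiv (i := i)) t v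
    have h0 : (fun i => t ^ (1 : σ → ℕ) i * v i) = t • v := by
      ext
      simp
    rw [h0] at this
    exact this
  have h2 : gradient v f = (t ^ (d - 1))⁻¹ • gradient (t • v) f := by
    rw [h1, smul_smul, inv_mul_cancel₀ (pow_ne_zero _ ht), one_smul]
  change gradient v f ∈ _
  rw [h2]
  exact Submodule.smul_mem _ _ (gradient_mem_normalSpan _ hf)

theorem IsIrreducibleCone.smul_mem_conormalCone {V : Set (σ → ℂ)} (hV : IsIrreducibleCone V)
    {t s : ℂ} (ht : t ≠ 0) {p q : σ → ℂ} (h : Sum.elim p q ∈ conormalCone V) :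
    Sum.elim (t • p) (s • q) ∈ conormalCone V := by
  rw [mem_conormalCone] at *
  exact ⟨hV.smul_mem t p h.1, Submodule.smul_mem _ _ (hV.normalSpan_smul h.2 ht)⟩

/-- The zero set of the conormal ideal is stable under scaling both vectors. -/
theorem IsIrreducibleCone.zeroLocus_conormalIdeal_smul {V : Set (σ → ℂ)} (hV : IsIrreducibleCone V)
    {t s : ℂ} (ht : t ≠ 0) {p q : σ → ℂ} (h : ∀ F ∈ conormalIdeal V, aeval (Sum.elim p q) F = 0) :
    ∀ F ∈ conormalIdeal V, aeval (Sum.elim (t • p) (s • q)) F = 0 := by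
  intro F hF
  let F' : MvPolynomial (σ ⊕ σ) ℂ :=
    aeval (Sum.elim (fun i => C t * X (Sum.inl i)) (fun i => C s * X (Sum.inr i))) F
  have hF' : ∀ p q : σ → ℂ, aeval (Sum.elim p q) F' = aeval (Sum.elim (t • p) (s • q)) F := by
    intro p q
    rw [comp_aeval_apply]
    congr 2
    ext i
    cases i <;> simp
  rw [← hF']
  apply h
  rw [conormalIdeal, mem_vanishingIdeal_iff]
  intro z hz
  rw [← Sum.elim_comp_inl_inr z, hF']
  refine mem_vanishingIdeal_iff.1 hF _ (hV.smul_mem_conormalCone ht ?_)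
  rwa [Sum.elim_comp_inl_inr]

theorem conormalIdeal_isPrime [Fintype σ] {V : Set (σ → ℂ)} (hV : IsIrreducibleCone V) :
    (conormalIdeal V).IsPrime := by
  obtain ⟨c⟩ := exists_conormalField hV
  rw [← c.ker_eq]
  exact RingHom.ker_isPrime _

theorem rename_inl_mem_conormalIdeal {V : Set (σ → ℂ)} {f : MvPolynomial σ ℂ} :
    rename Sum.inl f ∈ conormalIdeal V ↔ f ∈ vanishingIdeal ℂ V := by
  rw [conormalIdeal, mem_vanishingIdeal_iff, mem_vanishingIdeal_iff]
  simp only [aeval_rename]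
  constructor
  · intro h v hv
    have := h (Sum.elim v 0) (mem_conormalCone.2 ⟨hv, Submodule.zero_mem _⟩)
    simpa using this
  · intro h z hz
    exact h _ hz.1

end ConormalScaling

/-! ### From projective varieties to affine cones. -/

section Projective

variable {σ : Type}

theorem rep_mem_affineCone {X : Set (ProjSpace σ)} {x : ProjSpace σ} :
    x.rep ∈ affineCone X ↔ x ∈ X := by
  constructor
  · intro h
    have := h x.rep_nonzero
    rwa [Projectivization.mk_rep] at this
  · intro h _
    rwa [Projectivization.mk_rep]

theorem smul_mem_affineCone {X : Set (ProjSpace σ)} (t : ℂ) {v : σ → ℂ} (hv : v ∈ affineCone X) :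
    t • v ∈ affineCone X := by
  intro h0
  have ht : t ≠ 0 := fun h => h0 (by simp [h])
  have hv0 : v ≠ 0 := fun h => h0 (by simp [h])
  have : Projectivization.mk ℂ (t • v) h0 = Projectivization.mk ℂ v hv0 :=
    (Projectivization.mk_eq_mk_iff' ℂ _ _ _ _).2 ⟨t, rfl⟩
  rw [this]
  exact hv hv0

theorem isIrreducibleCone_affineCone {X : Set (ProjSpace σ)} (hX : (homIdeal X).IsPrime) :
    IsIrreducibleCone (affineCone X) where
  zero_mem := fun h => absurd rfl h
  smul_mem := fun t _ hv => smul_mem_affineCone t hv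
  prime := hX

theorem exists_smul_rep {v : σ → ℂ} (hv : v ≠ 0) :
    ∃ t : ℂ, t ≠ 0 ∧ v = t • (Projectivization.mk ℂ v hv).rep := by
  obtain ⟨a, ha⟩ := Projectivization.exists_smul_eq_mk_rep ℂ v hv
  refine ⟨(a⁻¹ : ℂˣ), Units.ne_zero _, ?_⟩
  rw [← ha]
  exact (inv_smul_smul a v).symm

variable [Fintype σ]

theorem tangentSpace_eq_perp (X : Set (ProjSpace σ)) (x : ProjSpace σ) :
    tangentSpace X x = perp (normalSpan (homIdeal X : Set (MvPolynomial σ ℂ)) x.rep) := by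
  ext v
  rw [mem_perp]
  constructor
  · intro hv w hw
    obtain ⟨n, c, h, hI, rfl⟩ := mem_normalSpan_iff.1 hw
    simp only [Finset.sum_mul]
    rw [Finset.sum_comm]
    refine Finset.sum_eq_zero fun j _ => ?_
    simp only [mul_assoc]
    rw [← Finset.mul_sum]
    exact (congrArg (c j * ·) (hv (h j) (hI j))).trans (mul_zero _)
  · intro hv f hf
    exact hv _ (gradient_mem_normalSpan _ hf)

theorem orthogonal_tangentSpace_iff {X : Set (ProjSpace σ)} {x : ProjSpace σ} {q : σ → ℂ} :
    (∀ v ∈ tangentSpace X x, ∑ i, q i * v i = 0) ↔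
      q ∈ normalSpan (homIdeal X : Set (MvPolynomial σ ℂ)) x.rep := by
  rw [← perp_perp (normalSpan _ _), ← tangentSpace_eq_perp, mem_perp]
  simp only [mul_comm]

/-- The regular points contain the complement of a homogeneous hypersurface. -/
theorem exists_jacobianMinor_regular {X : Set (ProjSpace σ)} (hX : (homIdeal X).IsPrime)
    {ι : Type} (f : ι → MvPolynomial σ ℂ) (hf : ∀ j, f j ∈ homIdeal X)
    (hspan : ∀ h ∈ homIdeal X, gradient (genericPoint (homIdeal X)) h ∈
      Submodule.span (FunctionField (homIdeal X))
        (Set.range fun j => gradient (genericPoint (homIdeal X)) (f j))) :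
    ∃ (r : ℕ) (a : Fin r → ι) (s : Fin r → σ),
      coneDim X + (r : WithBot ℕ∞) = (Fintype.card σ : WithBot ℕ∞) ∧
      jacobianMinor f a s ∉ homIdeal X ∧
      (∀ (E : Type) [Field E] [Algebra ℂ E] (y : σ → E), (∀ h ∈ homIdeal X, aeval y h = 0) →
        aeval y (jacobianMinor f a s) ≠ 0 → normalSpan (homIdeal X : Set (MvPolynomial σ ℂ)) y =
          Submodule.span E (Set.range fun j => gradient y (f (a j)))) ∧
      ∀ x ∈ X, aeval x.rep (jacobianMinor f a s) ≠ 0 → x ∈ regularPoints X := by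
  obtain ⟨r, a, s, hr, hδ, hE⟩ := exists_jacobianMinor (homIdeal X) f hf hspan
  refine ⟨r, a, s, hr, hδ, hE, fun x hx h0 => ⟨hx, ?_⟩⟩
  obtain ⟨d, -, -, hd, -⟩ := finrank_normalSpan_genericPoint (homIdeal X)
  have h1 := finrank_perp (normalSpan (homIdeal X : Set (MvPolynomial σ ℂ)) x.rep)
  rw [← tangentSpace_eq_perp] at h1
  have hvan : ∀ h ∈ homIdeal X, aeval x.rep h = 0 := fun h hh =>
    mem_vanishingIdeal_iff.1 hh _ (rep_mem_affineCone.2 hx)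
  rw [hE ℂ x.rep hvan h0,
    finrank_span_eq_card (linearIndependent_of_aeval_jacobianMinor f a s h0), Fintype.card_fin] at h1
  rw [hd] at hr
  rw [coneDim, hd]
  have hr' : d + r = Fintype.card σ := by exact_mod_cast hr
  have : Module.finrank ℂ (tangentSpace X x) = d := by omega
  rw [this]

theorem aeval_smul_smul_eq_zero {τ : Type} {F : MvPolynomial (τ ⊕ τ) ℂ} {d e : ℕ}
    (hF : IsBihomogeneous F d e) {t s : ℂ} {p q : τ → ℂ} (h : aeval (Sum.elim p q) F = 0) :
    aeval (Sum.elim (t • p) (s • q)) F = 0 := by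
  have h1 := aeval_scale_of_isWeightedHomogeneous hF.1 t (Sum.elim p q)
  have h2 := aeval_scale_of_isWeightedHomogeneous hF.2 s (Sum.elim (t • p) q)
  have e1 : (fun i => t ^ (Sum.elim (fun _ => 1) (fun _ => 0) : τ ⊕ τ → ℕ) i * Sum.elim p q i) =
      Sum.elim (t • p) q := by
    ext i
    cases i <;> simp
  have e2 : (fun i => s ^ (Sum.elim (fun _ => 0) (fun _ => 1) : τ ⊕ τ → ℕ) i *
      Sum.elim (t • p) q i) = Sum.elim (t • p) (s • q) := by
    ext i
    cases i <;> simp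
  rw [e1] at h1
  rw [e2] at h2
  rw [h2, h1, h, mul_zero, mul_zero]

/-- Membership in the conormal variety is given by the conormal ideal of the affine cone. -/
theorem mem_conormalVariety_iff {X : Set (ProjSpace σ)} (hX : (homIdeal X).IsPrime)
    (hne : X.Nonempty) {x y : ProjSpace σ} :
    (x, y) ∈ conormalVariety X ↔
      ∀ F ∈ conormalIdeal (affineCone X), aeval (Sum.elim x.rep y.rep) F = 0 := by
  have hV := isIrreducibleCone_affineCone hX
  constructor
  · intro hxy F hF
    -- The closure only tests bihomogeneous polynomials, so `F` is split by its degree in the first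
    -- group of variables, then in the second; both kinds of component stay in the conormal ideal.
    obtain ⟨s, hs⟩ := sum_weightedHomogeneousComponent_eq
      (Sum.elim (fun _ => 1) (fun _ => 0) : σ ⊕ σ → ℕ) F
    rw [hs, map_sum]
    refine Finset.sum_eq_zero fun d _ => ?_
    set G := weightedHomogeneousComponent (Sum.elim (fun _ => 1) (fun _ => 0) : σ ⊕ σ → ℕ) d F
    have hG : G ∈ conormalIdeal (affineCone X) := by
      refine weightedHomogeneousComponent_mem_vanishingIdeal (fun t ht z hz => ?_) hF d
      rw [← Sum.elim_comp_inl_inr z] at hz ⊢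
      have := hV.smul_mem_conormalCone (s := 1) ht hz
      convert! this using 1
      ext i
      cases i <;> simp
    obtain ⟨s', hs'⟩ := sum_weightedHomogeneousComponent_eq
      (Sum.elim (fun _ => 0) (fun _ => 1) : σ ⊕ σ → ℕ) G
    rw [hs', map_sum]
    refine Finset.sum_eq_zero fun e _ => ?_
    have hH : weightedHomogeneousComponent (Sum.elim (fun _ => 0) (fun _ => 1) : σ ⊕ σ → ℕ) e G ∈
        conormalIdeal (affineCone X) := by
      refine weightedHomogeneousComponent_mem_vanishingIdeal (fun t ht z hz => ?_) hG e
      rw [← Sum.elim_comp_inl_inr z] at hz ⊢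
      have := hV.smul_mem_conormalCone (s := t) one_ne_zero hz
      convert! this using 1
      ext i
      cases i <;> simp
    refine hxy _ d e ⟨isWeightedHomogeneous_weightedHomogeneousComponent
      (weightedHomogeneousComponent_isWeightedHomogeneous d F),
      weightedHomogeneousComponent_isWeightedHomogeneous e G⟩ fun z hz => ?_
    refine mem_vanishingIdeal_iff.1 hH _ (mem_conormalCone.2 ⟨?_, ?_⟩)
    · exact rep_mem_affineCone.2 hz.1.1
    · exact orthogonal_tangentSpace_iff.1 hz.2
  · intro h F d e hF hZ
    obtain ⟨k, hk⟩ : ∃ k, y.rep k ≠ 0 := Function.ne_iff.1 y.rep_nonzero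
    obtain ⟨x₀, hx₀⟩ := hne
    obtain ⟨l, hl⟩ : ∃ l, x₀.rep l ≠ 0 := Function.ne_iff.1 x₀.rep_nonzero
    obtain ⟨r, a, s, -, hδ, hE, hreg⟩ := exists_jacobianMinor_regular hX
      (fun f : {f : MvPolynomial σ ℂ // f ∈ homIdeal X ∧ ∃ d, f.IsHomogeneous d} => f.1)
      (fun j => j.2.1) (fun h hh => hV.gradient_mem_span_homogeneous _ hh)
    set f := fun f : {f : MvPolynomial σ ℂ // f ∈ homIdeal X ∧ ∃ d, f.IsHomogeneous d} => f.1
    obtain ⟨m, hm⟩ := isHomogeneous_jacobianMinor (f := f) (fun j => j.2.2) a s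
    have hl' : (MvPolynomial.X l : MvPolynomial σ ℂ) ∉ homIdeal X := fun hX' => hl (by
      simpa using mem_vanishingIdeal_iff.1 hX' _ (rep_mem_affineCone.2 hx₀))
    have hprime := conormalIdeal_isPrime hV
    -- The three extra factors remove the conormal vectors that give no regular projective pair:
    -- those with singular base point, zero base point or zero covector.
    have hmem : rename Sum.inl (jacobianMinor f a s) * rename Sum.inl (MvPolynomial.X l) *
        (F * MvPolynomial.X (Sum.inr k)) ∈ conormalIdeal (affineCone X) := by
      rw [conormalIdeal, mem_vanishingIdeal_iff]
      intro z hz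
      rw [← Sum.elim_comp_inl_inr z] at hz ⊢
      set v := z ∘ Sum.inl
      set q := z ∘ Sum.inr
      rw [mem_conormalCone] at hz
      simp only [map_mul, aeval_rename, aeval_X, Sum.elim_inr]
      rw [Sum.elim_comp_inl]
      by_cases h1 : aeval v (jacobianMinor f a s) = 0
      · simp [h1]
      by_cases h2 : v l = 0
      · simp [h2]
      by_cases h3 : q k = 0
      · simp [h3]
      have hv : v ≠ 0 := fun h => h2 (by simp [h])
      have hq : q ≠ 0 := fun h => h3 (by simp [h])
      obtain ⟨t, ht, hvt⟩ := exists_smul_rep hv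
      obtain ⟨t', ht', hqt⟩ := exists_smul_rep hq
      suffices hF0 : aeval (Sum.elim v q) F = 0 by simp [hF0]
      have h4 : aeval (Projectivization.mk ℂ v hv).rep (jacobianMinor f a s) ≠ 0 := by
        intro h0
        apply h1
        rw [hvt]
        have := aeval_scale_of_isWeightedHomogeneous hm t (Projectivization.mk ℂ v hv).rep
        simp only [Pi.one_apply, pow_one] at this
        rw [h0, mul_zero] at this
        exact this
      have hmkX : Projectivization.mk ℂ v hv ∈ X := hz.1 hv
      have h5 := hZ (Projectivization.mk ℂ v hv, Projectivization.mk ℂ q hq) ⟨hreg _ hmkX h4, by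
        rw [orthogonal_tangentSpace_iff]
        have h6 := hV.normalSpan_smul (t := t⁻¹) hz.2 (inv_ne_zero ht)
        have h7 : t⁻¹ • v = (Projectivization.mk ℂ v hv).rep := by
          conv_lhs => rw [hvt]
          rw [smul_smul, inv_mul_cancel₀ ht, one_smul]
        have h8 : t'⁻¹ • q = (Projectivization.mk ℂ q hq).rep := by
          conv_lhs => rw [hqt]
          rw [smul_smul, inv_mul_cancel₀ ht', one_smul]
        rw [h7] at h6
        dsimp only
        rw [← h8]
        exact Submodule.smul_mem _ _ h6⟩
      rw [hvt, hqt]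
      exact aeval_smul_smul_eq_zero hF h5
    -- Primality removes the minor and `X l`. The coordinate `X (Sum.inr k)` may itself lie in the
    -- conormal ideal, as for `X` the whole space; it is cancelled only at `y`, where it is nonzero.
    have h1 := (hprime.mem_or_mem hmem).resolve_left fun h1 =>
      (hprime.mem_or_mem h1).elim (fun h2 => hδ (rename_inl_mem_conormalIdeal.1 h2))
        (fun h2 => hl' (rename_inl_mem_conormalIdeal.1 h2))
    have h2 := h _ h1
    rw [map_mul, aeval_X, Sum.elim_inr] at h2
    exact (mul_eq_zero.1 h2).resolve_right hk

/-- The ideal of the dual variety. -/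
theorem homIdeal_dualVariety {X : Set (ProjSpace σ)} (hX : (homIdeal X).IsPrime)
    (hne : X.Nonempty) :
    homIdeal (dualVariety X) =
      (conormalIdeal (affineCone X)).comap (rename Sum.inr : MvPolynomial σ ℂ →ₐ[ℂ] _) := by
  have hV := isIrreducibleCone_affineCone hX
  have hmem : ∀ p q : σ → ℂ, p ≠ 0 → ∀ hq : q ≠ 0,
      (∀ F ∈ conormalIdeal (affineCone X), aeval (Sum.elim p q) F = 0) →
      Projectivization.mk ℂ q hq ∈ dualVariety X := by
    intro p q hp hq h
    refine ⟨(Projectivization.mk ℂ p hp, Projectivization.mk ℂ q hq), ?_, rfl⟩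
    rw [mem_conormalVariety_iff hX hne]
    obtain ⟨t, ht, hpt⟩ := exists_smul_rep hp
    obtain ⟨s, hs, hqs⟩ := exists_smul_rep hq
    have h7 : t⁻¹ • p = (Projectivization.mk ℂ p hp).rep := by
      conv_lhs => rw [hpt]
      rw [smul_smul, inv_mul_cancel₀ ht, one_smul]
    have h8 : s⁻¹ • q = (Projectivization.mk ℂ q hq).rep := by
      conv_lhs => rw [hqs]
      rw [smul_smul, inv_mul_cancel₀ hs, one_smul]
    rw [← h7, ← h8]
    exact hV.zeroLocus_conormalIdeal_smul (inv_ne_zero ht) h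
  obtain ⟨x₀, hx₀⟩ := hne
  obtain ⟨l, hl⟩ : ∃ l, x₀.rep l ≠ 0 := Function.ne_iff.1 x₀.rep_nonzero
  have hl' : (MvPolynomial.X l : MvPolynomial σ ℂ) ∉ homIdeal X := fun hX' => hl (by
    simpa using mem_vanishingIdeal_iff.1 hX' _ (rep_mem_affineCone.2 hx₀))
  ext f
  rw [Ideal.mem_comap]
  constructor
  · intro hf
    -- Conormal vectors over the origin give no projective pair, so a coordinate nonzero somewhere
    -- on `X` is multiplied in and removed again by primality.
    have h1 : rename Sum.inl (MvPolynomial.X l) * rename Sum.inr f ∈ conormalIdeal (affineCone X) := by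
      rw [conormalIdeal, mem_vanishingIdeal_iff]
      intro z hz
      rw [← Sum.elim_comp_inl_inr z] at hz ⊢
      set v := z ∘ Sum.inl
      set q := z ∘ Sum.inr
      simp only [map_mul, aeval_rename, aeval_X, Sum.elim_comp_inr, Sum.elim_comp_inl]
      by_cases hv : v l = 0
      · simp [hv]
      refine mul_eq_zero_of_right _ (mem_vanishingIdeal_iff.1 hf _ ?_)
      intro hq
      exact hmem v q (fun h => hv (by simp [h])) hq fun F hF => mem_vanishingIdeal_iff.1 hF _ hz
    exact ((conormalIdeal_isPrime hV).mem_or_mem h1).resolve_left fun h2 =>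
      hl' (rename_inl_mem_conormalIdeal.1 h2)
  · intro hf
    refine mem_vanishingIdeal_iff.2 fun q hq => ?_
    by_cases hq0 : q = 0
    · have := mem_vanishingIdeal_iff.1 hf (Sum.elim x₀.rep 0)
        (mem_conormalCone.2 ⟨rep_mem_affineCone.2 hx₀, Submodule.zero_mem _⟩)
      change aeval _ (rename Sum.inr f) = 0 at this
      rw [aeval_rename, Sum.elim_comp_inr] at this
      rw [hq0, this]
    · obtain ⟨⟨x, y⟩, hxy, hy⟩ := hq hq0
      rw [mem_conormalVariety_iff hX ⟨x₀, hx₀⟩] at hxy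
      obtain ⟨t, ht, hqt⟩ := exists_smul_rep hq0
      have := hV.zeroLocus_conormalIdeal_smul (t := 1) (s := t) one_ne_zero hxy _ hf
      change aeval _ (rename Sum.inr f) = 0 at this
      rw [aeval_rename, Sum.elim_comp_inr] at this
      rw [hqt, ← hy]
      exact this

theorem isPrime_homIdeal_dualVariety {X : Set (ProjSpace σ)} (hX : (homIdeal X).IsPrime)
    (hne : X.Nonempty) : (homIdeal (dualVariety X)).IsPrime := by
  have := conormalIdeal_isPrime (isIrreducibleCone_affineCone hX)
  rw [homIdeal_dualVariety hX hne]
  exact Ideal.comap_isPrime _ _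

end Projective

/-! ### The conormal variety of `X'` in terms of that of `X`. -/

section SumEmbedding

variable {n : ℕ}

/-- The point `(p_0, …, p_n, p_0 + ⋯ + p_n)`. -/
def sumExt {E : Type} [CommRing E] (p : Fin (n + 1) → E) : Fin (n + 2) → E :=
  Fin.snoc (α := fun _ => E) p (∑ i, p i)

/-- The vector `(b_0 + b_s, …, b_n + b_s)`. -/
def shiftVec {E : Type} [CommRing E] : (Fin (n + 2) → E) →ₗ[E] (Fin (n + 1) → E) where
  toFun b := fun i => b i.castSucc + b (Fin.last (n + 1))
  map_add' b c := by
    ext i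
    simp only [Pi.add_apply]
    ring
  map_smul' t b := by
    ext i
    simp only [Pi.smul_apply, smul_eq_mul, RingHom.id_apply]
    ring

theorem shiftVec_apply {E : Type} [CommRing E] (b : Fin (n + 2) → E) (i : Fin (n + 1)) :
    shiftVec b i = b i.castSucc + b (Fin.last (n + 1)) := rfl

section

variable {E : Type} [CommRing E]

@[simp] theorem sumExt_castSucc (p : Fin (n + 1) → E) (i : Fin (n + 1)) :
    sumExt p i.castSucc = p i := by simp [sumExt]

@[simp] theorem sumExt_last (p : Fin (n + 1) → E) :
    sumExt p (Fin.last (n + 1)) = ∑ i, p i := by simp [sumExt]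

theorem eq_sumExt_iff {w : Fin (n + 2) → E} {p : Fin (n + 1) → E} :
    w = sumExt p ↔ (∀ i : Fin (n + 1), w i.castSucc = p i) ∧ w (Fin.last (n + 1)) = ∑ i, p i := by
  constructor
  · rintro rfl
    simp
  · rintro ⟨h1, h2⟩
    ext i
    refine Fin.lastCases ?_ (fun i => ?_) i
    · simp [h2]
    · simp [h1]

variable [Algebra ℂ E]

/-- The chain rule for the restriction to the hyperplane `p_s = p_0 + ⋯ + p_n`. -/
theorem shiftVec_gradient_sumExt (p : Fin (n + 1) → E) (h : MvPolynomial (Fin (n + 2)) ℂ) :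
    shiftVec (gradient (sumExt p) h) =
      gradient p (aeval (sumExt (X : Fin (n + 1) → MvPolynomial (Fin (n + 1)) ℂ)) h) := by
  ext i
  rw [gradient, derivation_aeval, map_sum, Fin.sum_univ_castSucc, shiftVec_apply]
  have hg : ∀ k, aeval p (gradient
      (sumExt (X : Fin (n + 1) → MvPolynomial (Fin (n + 1)) ℂ)) h k) = gradient (sumExt p) h k := by
    intro k
    rw [gradient, comp_aeval_apply, gradient]
    congr 2
    ext k
    refine Fin.lastCases ?_ (fun k => ?_) k <;> simp
  congr 1
  · rw [Finset.sum_eq_single i]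
    · simp [hg]
    · intro k _ hk
      simp [pderiv_X_of_ne hk]
    · simp
  · have : (pderiv i) (∑ k, X k : MvPolynomial (Fin (n + 1)) ℂ) = 1 := by
      rw [map_sum, Finset.sum_eq_single i]
      · simp
      · intro k _ hk
        rw [pderiv_X_of_ne hk]
      · simp
    rw [sumExt_last, this, smul_eq_mul, mul_one, hg]

end

variable {X : Set (ProjSpace (Fin (n + 1)))}

theorem mem_affineCone_sumEmbedding {w : Fin (n + 2) → ℂ} :
    w ∈ affineCone (sumEmbedding X) ↔ ∃ p ∈ affineCone X, w = sumExt p := by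
  by_cases hw : w = 0
  · subst hw
    refine iff_of_true (fun h => absurd rfl h) ⟨0, fun h => absurd rfl h, ?_⟩
    rw [eq_sumExt_iff]
    simp
  obtain ⟨t, ht, hwt⟩ := exists_smul_rep hw
  have hwt' : (Projectivization.mk ℂ w hw).rep = t⁻¹ • w := by
    conv_rhs => rw [hwt]
    rw [smul_smul, inv_mul_cancel₀ ht, one_smul]
  constructor
  · intro h
    obtain ⟨h1, h2⟩ := h hw
    refine ⟨fun i => w i.castSucc, ?_, ?_⟩
    · have := smul_mem_affineCone t h1
      convert! this using 1
      ext i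
      conv_lhs => rw [hwt]
      rfl
    · rw [eq_sumExt_iff]
      refine ⟨fun _ => rfl, ?_⟩
      conv_lhs => rw [hwt]
      conv_rhs => rw [hwt]
      simp only [Pi.smul_apply, smul_eq_mul, h2, Finset.mul_sum]
  · rintro ⟨p, hp, rfl⟩ _
    refine ⟨?_, ?_⟩
    · rw [hwt']
      have := smul_mem_affineCone t⁻¹ hp
      convert! this using 1
      ext i
      simp
    · rw [hwt']
      simp [Finset.mul_sum]

theorem mem_homIdeal_sumEmbedding {h : MvPolynomial (Fin (n + 2)) ℂ} :
    h ∈ homIdeal (sumEmbedding X) ↔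
      aeval (sumExt (MvPolynomial.X : Fin (n + 1) → MvPolynomial (Fin (n + 1)) ℂ)) h ∈ homIdeal X := by
  have key : ∀ p : Fin (n + 1) → ℂ, aeval p (aeval (sumExt
      (MvPolynomial.X : Fin (n + 1) → MvPolynomial (Fin (n + 1)) ℂ)) h) = aeval (sumExt p) h := by
    intro p
    rw [comp_aeval_apply]
    congr 2
    ext k
    refine Fin.lastCases ?_ (fun k => ?_) k <;> simp
  rw [homIdeal, homIdeal, mem_vanishingIdeal_iff, mem_vanishingIdeal_iff]
  constructor
  · intro H p hp
    rw [key]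
    exact H _ (mem_affineCone_sumEmbedding.2 ⟨p, hp, rfl⟩)
  · intro H w hw
    obtain ⟨p, hp, rfl⟩ := mem_affineCone_sumEmbedding.1 hw
    rw [← key]
    exact H p hp

theorem isPrime_homIdeal_sumEmbedding (hX : (homIdeal X).IsPrime) :
    (homIdeal (sumEmbedding X)).IsPrime := by
  have : homIdeal (sumEmbedding X) = (homIdeal X).comap
      (aeval (sumExt (MvPolynomial.X : Fin (n + 1) → MvPolynomial (Fin (n + 1)) ℂ))) := by
    ext h
    exact mem_homIdeal_sumEmbedding
  rw [this]
  exact Ideal.comap_isPrime _ _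

theorem sumEmbedding_nonempty (hne : X.Nonempty) : (sumEmbedding X).Nonempty := by
  obtain ⟨x, hx⟩ := hne
  have h0 : sumExt x.rep ≠ 0 := by
    intro h
    apply x.rep_nonzero
    ext i
    have := congr_fun h i.castSucc
    simpa using this
  have h1 := mem_affineCone_sumEmbedding.2 ⟨x.rep, rep_mem_affineCone.2 hx, rfl⟩
  exact ⟨_, h1 h0⟩

/-- `shiftVec` is the transpose of the linear embedding `sumExt`, so it carries normal vectors of
the image to normal vectors of the source. Its kernel is spanned by the gradient of the equation of
the hyperplane. -/
theorem mem_conormalCone_sumEmbedding {w b : Fin (n + 2) → ℂ} :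
    Sum.elim w b ∈ conormalCone (affineCone (sumEmbedding X)) ↔
      ∃ p, w = sumExt p ∧ Sum.elim p (shiftVec b) ∈ conormalCone (affineCone X) := by
  rw [mem_conormalCone]
  constructor
  · rintro ⟨hw, hb⟩
    obtain ⟨p, hp, rfl⟩ := mem_affineCone_sumEmbedding.1 hw
    refine ⟨p, rfl, mem_conormalCone.2 ⟨hp, ?_⟩⟩
    have : normalSpan (homIdeal (sumEmbedding X) : Set (MvPolynomial (Fin (n + 2)) ℂ)) (sumExt p) ≤
        (normalSpan (homIdeal X : Set (MvPolynomial (Fin (n + 1)) ℂ)) p).comap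
          (shiftVec (E := ℂ) (n := n)) := by
      rw [normalSpan, Submodule.span_le]
      rintro _ ⟨h, hh, rfl⟩
      change shiftVec (gradient (sumExt p) h) ∈
        normalSpan (homIdeal X : Set (MvPolynomial (Fin (n + 1)) ℂ)) p
      rw [shiftVec_gradient_sumExt]
      exact gradient_mem_normalSpan _ (mem_homIdeal_sumEmbedding.1 hh)
    have h2 : shiftVec b ∈ normalSpan (homIdeal X : Set (MvPolynomial (Fin (n + 1)) ℂ)) p := this hb
    exact h2
  · rintro ⟨p, rfl, hp⟩
    rw [mem_conormalCone] at hp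
    refine ⟨mem_affineCone_sumEmbedding.2 ⟨p, hp.1, rfl⟩, ?_⟩
    obtain ⟨m, c, h, hI, hb⟩ := mem_normalSpan_iff.1 hp.2
    let ℓ : MvPolynomial (Fin (n + 2)) ℂ :=
      MvPolynomial.X (Fin.last (n + 1)) - ∑ i : Fin (n + 1), MvPolynomial.X i.castSucc
    have hℓ : ℓ ∈ homIdeal (sumEmbedding X) := by
      rw [mem_homIdeal_sumEmbedding]
      simp [ℓ]
    have hr : ∀ j, rename Fin.castSucc (h j) ∈ homIdeal (sumEmbedding X) := by
      intro j
      rw [mem_homIdeal_sumEmbedding, aeval_rename]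
      have : (sumExt (MvPolynomial.X : Fin (n + 1) → MvPolynomial (Fin (n + 1)) ℂ)) ∘ Fin.castSucc =
          MvPolynomial.X := by
        ext i
        simp
      rw [this, aeval_X_left_apply]
      exact hI j
    have hgr : ∀ j, (∀ i : Fin (n + 1), gradient (sumExt p) (rename Fin.castSucc (h j)) i.castSucc =
        gradient p (h j) i) ∧
        gradient (sumExt p) (rename Fin.castSucc (h j)) (Fin.last (n + 1)) = 0 := by
      intro j
      constructor
      · intro i
        rw [gradient, pderiv_rename (Fin.castSucc_injective _), aeval_rename, gradient]
        congr 2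
        ext i
        simp
      · rw [gradient, pderiv_eq_zero_of_notMem_vars, map_zero]
        intro hmem
        obtain ⟨i, -, hi⟩ := Finset.mem_image.1 (vars_rename Fin.castSucc (h j) hmem)
        exact (Fin.castSucc_lt_last i).ne hi
    have hgl : (∀ i : Fin (n + 1), gradient (sumExt p) ℓ i.castSucc = -1) ∧
        gradient (sumExt p) ℓ (Fin.last (n + 1)) = 1 := by
      constructor
      · intro i
        simp only [gradient, ℓ, map_sub, map_sum]
        rw [pderiv_X_of_ne (Fin.castSucc_lt_last i).ne', Finset.sum_eq_single i]
        · simp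
        · intro k _ hk
          rw [pderiv_X_of_ne (fun h => hk (Fin.castSucc_injective _ h)), map_zero]
        · simp
      · simp only [gradient, ℓ, map_sub, map_sum]
        rw [Finset.sum_eq_zero]
        · simp
        · intro k _
          rw [pderiv_X_of_ne (Fin.castSucc_lt_last k).ne, map_zero]
    -- The multiple of the hyperplane gradient is forced by the last coordinate, since the
    -- polynomials lifted from `X` do not involve `p_s`.
    have : b = (∑ j, c j • gradient (sumExt p) (rename Fin.castSucc (h j))) +
        b (Fin.last (n + 1)) • gradient (sumExt p) ℓ := by
      ext i
      refine Fin.lastCases ?_ (fun i => ?_) i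
      · simp [hgr, hgl]
      · have := congr_fun hb i
        rw [shiftVec_apply] at this
        simp only [Pi.add_apply, Finset.sum_apply, Pi.smul_apply, smul_eq_mul, (hgr _).1, hgl.1]
        rw [← this]
        ring
    rw [this]
    refine Submodule.add_mem _ (Submodule.sum_mem _ fun j _ => Submodule.smul_mem _ _ ?_)
      (Submodule.smul_mem _ _ ?_)
    · exact gradient_mem_normalSpan _ (hr j)
    · exact gradient_mem_normalSpan _ hℓ

/-- The preceding equivalence for Zariski closures: polynomials are pulled back along the linear
maps relating the two conormal cones. -/
theorem zeroLocus_conormalIdeal_sumEmbedding {w b : Fin (n + 2) → ℂ} :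
    (∀ F ∈ conormalIdeal (affineCone (sumEmbedding X)), aeval (Sum.elim w b) F = 0) ↔
      ∃ p, w = sumExt p ∧
        ∀ F ∈ conormalIdeal (affineCone X), aeval (Sum.elim p (shiftVec b)) F = 0 := by
  constructor
  · intro H
    refine ⟨fun i => w i.castSucc, ?_, fun G hG => ?_⟩
    · rw [eq_sumExt_iff]
      refine ⟨fun _ => rfl, ?_⟩
      have := H (rename Sum.inl (MvPolynomial.X (Fin.last (n + 1)) -
        ∑ i : Fin (n + 1), MvPolynomial.X i.castSucc)) (rename_inl_mem_conormalIdeal.2 (by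
          change _ ∈ homIdeal (sumEmbedding X)
          rw [mem_homIdeal_sumEmbedding]
          simp))
      rw [aeval_rename, Sum.elim_comp_inl] at this
      simpa [sub_eq_zero] using this
    · let G' : MvPolynomial (Fin (n + 2) ⊕ Fin (n + 2)) ℂ := aeval (Sum.elim
        (fun i : Fin (n + 1) => MvPolynomial.X (Sum.inl i.castSucc))
        (fun i : Fin (n + 1) => MvPolynomial.X (Sum.inr i.castSucc) +
          MvPolynomial.X (Sum.inr (Fin.last (n + 1))))) G
      have hG' : ∀ w b : Fin (n + 2) → ℂ, aeval (Sum.elim w b) G' =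
          aeval (Sum.elim (fun i : Fin (n + 1) => w i.castSucc) (shiftVec b)) G := by
        intro w b
        rw [comp_aeval_apply]
        congr 2
        ext i
        cases i <;> simp [shiftVec_apply]
      rw [← hG']
      apply H
      rw [conormalIdeal, mem_vanishingIdeal_iff]
      intro z hz
      rw [← Sum.elim_comp_inl_inr z] at hz ⊢
      obtain ⟨p, hp, hpb⟩ := mem_conormalCone_sumEmbedding.1 hz
      rw [hG', hp]
      simp only [sumExt_castSucc]
      exact mem_vanishingIdeal_iff.1 hG _ hpb
  · rintro ⟨p, rfl, H⟩ F hF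
    -- The section `q ↦ (q_i - b_s, b_s)` of `shiftVec`, with the value of `b_s` frozen at that of
    -- the given `b`, so that it returns `b` itself.
    let F' : MvPolynomial (Fin (n + 1) ⊕ Fin (n + 1)) ℂ := aeval (Sum.elim
      (sumExt fun i => MvPolynomial.X (Sum.inl i))
      (Fin.snoc (α := fun _ => MvPolynomial (Fin (n + 1) ⊕ Fin (n + 1)) ℂ)
        (fun i => MvPolynomial.X (Sum.inr i) - C (b (Fin.last (n + 1))))
        (C (b (Fin.last (n + 1)))))) F
    have hF' : ∀ p q : Fin (n + 1) → ℂ, aeval (Sum.elim p q) F' =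
        aeval (Sum.elim (sumExt p) (Fin.snoc (α := fun _ => ℂ)
          (fun i => q i - b (Fin.last (n + 1))) (b (Fin.last (n + 1))))) F := by
      intro p q
      rw [comp_aeval_apply]
      congr 2
      ext i
      rcases i with i | i <;> refine Fin.lastCases ?_ (fun i => ?_) i <;> simp
    have hb : (Fin.snoc (α := fun _ => ℂ)
          (fun i => shiftVec b i - b (Fin.last (n + 1))) (b (Fin.last (n + 1)))) = b := by
      ext i
      refine Fin.lastCases ?_ (fun i => ?_) i <;> simp [shiftVec_apply]
    have h1 := hF' p (shiftVec b)
    rw [hb] at h1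
    rw [← h1]
    apply H
    rw [conormalIdeal, mem_vanishingIdeal_iff]
    intro z hz
    rw [← Sum.elim_comp_inl_inr z] at hz ⊢
    rw [hF']
    refine mem_vanishingIdeal_iff.1 hF _ (mem_conormalCone_sumEmbedding.2 ⟨_, rfl, ?_⟩)
    convert! hz using 2
    ext i
    simp [shiftVec_apply]

end SumEmbedding

/-! ### The family of pairs `(u, b)` and genericity of the data. -/

section Likelihood

variable {n : ℕ}

theorem aeval_option_eq {G : MvPolynomial (Option (Fin (n + 1))) ℂ} (u : Fin (n + 1) → ℂ) (s : ℂ) :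
    ((optionEquivLeft ℂ (Fin (n + 1)) G).map
      (aeval u : MvPolynomial (Fin (n + 1)) ℂ →ₐ[ℂ] ℂ).toRingHom).eval s =
      aeval (fun o : Option (Fin (n + 1)) => o.elim s u) G := by
  have h : (Polynomial.evalRingHom s).comp ((Polynomial.mapRingHom
      (aeval u : MvPolynomial (Fin (n + 1)) ℂ →ₐ[ℂ] ℂ).toRingHom).comp
        (optionEquivLeft ℂ (Fin (n + 1)) : MvPolynomial (Option (Fin (n + 1))) ℂ →+* _)) =
      (aeval (fun o : Option (Fin (n + 1)) => o.elim s u) :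
        MvPolynomial (Option (Fin (n + 1))) ℂ →ₐ[ℂ] ℂ).toRingHom := by
    refine MvPolynomial.ringHom_ext (fun a => ?_) fun o => ?_
    · simp
    · cases o <;> simp
  exact DFunLike.congr_fun h G

/-- A nonzero polynomial in `(u, s)` vanishes for all `s ≠ 0` only if `u` is special. -/
theorem exists_forall_ne_zero_of_option {G : MvPolynomial (Option (Fin (n + 1))) ℂ} (hG : G ≠ 0) :
    ∃ F : MvPolynomial (Fin (n + 1)) ℂ, F ≠ 0 ∧ ∀ u : Fin (n + 1) → ℂ,
      (∀ s : ℂ, s ≠ 0 → aeval (fun o : Option (Fin (n + 1)) => o.elim s u) G = 0) →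
        aeval u F = 0 := by
  set H := optionEquivLeft ℂ (Fin (n + 1)) G with hH
  have hH0 : H ≠ 0 := by
    rw [hH]
    exact (map_ne_zero_iff _ (optionEquivLeft ℂ (Fin (n + 1))).injective).2 hG
  -- The leading coefficient in `s` works: a polynomial in `s` with infinitely many roots has all
  -- its coefficients zero.
  refine ⟨H.leadingCoeff, Polynomial.leadingCoeff_ne_zero.2 hH0, fun u hu => ?_⟩
  have h0 : H.map (aeval u : MvPolynomial (Fin (n + 1)) ℂ →ₐ[ℂ] ℂ).toRingHom = 0 := by
    refine Polynomial.eq_zero_of_infinite_isRoot _ (Set.Infinite.mono (s := {0}ᶜ) ?_ ?_)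
    · intro s hs
      exact (aeval_option_eq u s).trans (hu s hs)
    · exact (Set.finite_singleton _).infinite_compl
  have h1 := congrArg (Polynomial.coeff · H.natDegree) h0
  simpa [Polynomial.coeff_map] using h1

/-- The substitution `u_i = p_i b_i`. -/
def productSubst (n : ℕ) : MvPolynomial (Fin (n + 1) ⊕ Fin (n + 2)) ℂ →ₐ[ℂ]
    MvPolynomial (Fin (n + 2) ⊕ Fin (n + 2)) ℂ :=
  aeval (Sum.elim (fun i => X (Sum.inl i.castSucc) * X (Sum.inr i.castSucc)) fun i => X (Sum.inr i))

theorem aeval_productSubst {E : Type} [CommRing E] [Algebra ℂ E] (p b : Fin (n + 2) → E)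
    (Φ : MvPolynomial (Fin (n + 1) ⊕ Fin (n + 2)) ℂ) :
    aeval (Sum.elim p b) (productSubst n Φ) =
      aeval (Sum.elim (fun i : Fin (n + 1) => p i.castSucc * b i.castSucc) b) Φ := by
  rw [productSubst, comp_aeval_apply]
  congr 2
  ext i
  cases i <;> simp

/-- The equations of the closure of the pairs `(u, b)` with `(p, b)` conormal to `V` and
`u_i = p_i b_i`. -/
def likelihoodIdeal (V : Set (Fin (n + 2) → ℂ)) : Ideal (MvPolynomial (Fin (n + 1) ⊕ Fin (n + 2)) ℂ) :=
  (conormalIdeal V).comap (productSubst n)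

theorem mem_likelihoodIdeal {V : Set (Fin (n + 2) → ℂ)}
    {Φ : MvPolynomial (Fin (n + 1) ⊕ Fin (n + 2)) ℂ} :
    Φ ∈ likelihoodIdeal V ↔ productSubst n Φ ∈ conormalIdeal V := Iff.rfl

theorem zeroLocus_likelihoodIdeal_smul {V : Set (Fin (n + 2) → ℂ)} (hV : IsIrreducibleCone V)
    {u : Fin (n + 1) → ℂ} {b : Fin (n + 2) → ℂ}
    (h : ∀ Φ ∈ likelihoodIdeal V, aeval (Sum.elim u b) Φ = 0) {t : ℂ} (ht : t ≠ 0) :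
    ∀ Φ ∈ likelihoodIdeal V, aeval (Sum.elim u (t • b)) Φ = 0 := by
  intro Φ hΦ
  let Φ' : MvPolynomial (Fin (n + 1) ⊕ Fin (n + 2)) ℂ :=
    aeval (Sum.elim (fun i => X (Sum.inl i)) fun i => C t * X (Sum.inr i)) Φ
  have hΦ' : ∀ (u : Fin (n + 1) → ℂ) (b : Fin (n + 2) → ℂ),
      aeval (Sum.elim u b) Φ' = aeval (Sum.elim u (t • b)) Φ := by
    intro u b
    rw [comp_aeval_apply]
    congr 2
    ext i
    cases i <;> simp
  rw [← hΦ']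
  apply h
  rw [mem_likelihoodIdeal, conormalIdeal, mem_vanishingIdeal_iff]
  intro z hz
  rw [← Sum.elim_comp_inl_inr z] at hz ⊢
  rw [aeval_productSubst, hΦ']
  -- Replacing `(p, b)` by `(t⁻¹ p, t b)` keeps the products `p_i b_i`.
  have h1 := mem_vanishingIdeal_iff.1 (mem_likelihoodIdeal.1 hΦ) _
    (hV.smul_mem_conormalCone (s := t) (inv_ne_zero ht) hz)
  rw [aeval_productSubst] at h1
  convert! h1 using 4
  ext i
  simp only [Pi.smul_apply, smul_eq_mul]
  field_simp

/-- For generic `u`, the points `b` over `u` avoid a hypersurface that does not contain the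
projection of the conormal variety. -/
theorem exists_generic_ne_zero {V : Set (Fin (n + 2) → ℂ)} (hV : IsIrreducibleCone V)
    {f : MvPolynomial (Fin (n + 2)) ℂ} (hf : rename Sum.inr f ∉ conormalIdeal V)
    (hhom : ∃ d, f.IsHomogeneous d) :
    ∃ F : MvPolynomial (Fin (n + 1)) ℂ, F ≠ 0 ∧
      ∀ (u : Fin (n + 1) → ℂ) (b : Fin (n + 2) → ℂ), aeval u F ≠ 0 → b ≠ 0 →
        (∀ Φ ∈ likelihoodIdeal V, aeval (Sum.elim u b) Φ = 0) → aeval b f ≠ 0 := by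
  obtain ⟨c⟩ := exists_conormalField hV
  obtain ⟨d, hd⟩ := hhom
  have hφ : aeval c.q f ≠ 0 := by
    intro h
    apply hf
    rw [← c.aeval_eq_zero, aeval_rename]
    exact h
  have key : ∀ k : Fin (n + 2), ∃ F : MvPolynomial (Fin (n + 1)) ℂ, F ≠ 0 ∧
      ∀ (u : Fin (n + 1) → ℂ) (b : Fin (n + 2) → ℂ), b k ≠ 0 →
        (∀ Φ ∈ likelihoodIdeal V, aeval (Sum.elim u b) Φ = 0) → aeval b f = 0 → aeval u F = 0 := by
    intro k
    -- The conormal field has transcendence degree `n + 2`, matched by the `n + 1` products `u_i`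
    -- and the single coordinate `b_k`; adding `f(b)` forces a relation.
    have hcard : Algebra.trdeg ℂ c.carrier ≤ Nat.card (Option (Fin (n + 1))) := by
      rw [c.trdeg_eq]
      simp only [Nat.card_eq_fintype_card, Fintype.card_option, Fintype.card_fin]
      exact le_rfl
    obtain ⟨G, hG0, hG⟩ := exists_relation_coeff_zero_ne hcard
      (fun o => o.elim (c.q k) fun i : Fin (n + 1) => c.p i.castSucc * c.q i.castSucc) hφ
    obtain ⟨F, hF, hFu⟩ := exists_forall_ne_zero_of_option hG0
    refine ⟨F, hF, fun u b hk hub hb => hFu u fun s hs => ?_⟩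
    let Γ : MvPolynomial (Fin (n + 1) ⊕ Fin (n + 2)) ℂ :=
      G.eval₂ (aeval fun o => o.elim (X (Sum.inr k)) fun i => X (Sum.inl i) :
        MvPolynomial (Option (Fin (n + 1))) ℂ →ₐ[ℂ] _).toRingHom (rename Sum.inr f)
    have hΓ : ∀ {L : Type} [Field L] [Algebra ℂ L] (u : Fin (n + 1) → L) (b : Fin (n + 2) → L),
        aeval (Sum.elim u b) Γ = G.eval₂ (aeval fun o => o.elim (b k) u :
          MvPolynomial (Option (Fin (n + 1))) ℂ →ₐ[ℂ] L).toRingHom (aeval b f) := by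
      intro L _ _ u b
      have h1 := Polynomial.hom_eval₂ G
        (aeval fun o => o.elim (X (Sum.inr k)) fun i => X (Sum.inl i) :
          MvPolynomial (Option (Fin (n + 1))) ℂ →ₐ[ℂ] MvPolynomial (Fin (n + 1) ⊕ Fin (n + 2)) ℂ).toRingHom
        (aeval (Sum.elim u b) : MvPolynomial (Fin (n + 1) ⊕ Fin (n + 2)) ℂ →ₐ[ℂ] L).toRingHom
        (rename Sum.inr f)
      refine h1.trans ?_
      have h2 : (aeval (Sum.elim u b) : MvPolynomial (Fin (n + 1) ⊕ Fin (n + 2)) ℂ →ₐ[ℂ] L).toRingHom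
          (rename Sum.inr f) = aeval b f := by
        refine (aeval_rename _ _ _).trans ?_
        rw [Sum.elim_comp_inr]
      rw [h2]
      congr 1
      refine MvPolynomial.ringHom_ext (fun a => ?_) fun o => ?_
      · simp [MvPolynomial.algebraMap_eq]
      · cases o <;> simp
    have hΓQ : Γ ∈ likelihoodIdeal V := by
      rw [mem_likelihoodIdeal, ← c.aeval_eq_zero, aeval_productSubst, hΓ]
      exact hG
    -- Rescaling `b` makes `b_k` equal to any `s ≠ 0` while `f(b) = 0` persists by homogeneity, so
    -- the constant coefficient of the relation vanishes at `(u, s)` for every such `s`.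
    have h1 := zeroLocus_likelihoodIdeal_smul hV hub (div_ne_zero hs hk) Γ hΓQ
    have h2 : aeval ((s / b k) • b) f = 0 := by
      have := aeval_scale_of_isWeightedHomogeneous hd (s / b k) b
      rw [hb, mul_zero] at this
      simp only [Pi.one_apply, pow_one] at this
      exact this
    rw [hΓ, h2, Polynomial.eval₂_at_zero] at h1
    have h3 : ((s / b k) • b) k = s := by
      simp only [Pi.smul_apply, smul_eq_mul]
      field_simp
    rw [h3] at h1
    exact h1
  choose F hF hFu using key
  -- The product covers all the charts `b_k ≠ 0`.
  refine ⟨∏ k, F k, Finset.prod_ne_zero_iff.2 fun k _ => hF k, fun u b hu hb hub h0 => ?_⟩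
  obtain ⟨k, hk⟩ := Function.ne_iff.1 hb
  apply hu
  rw [map_prod]
  exact Finset.prod_eq_zero (Finset.mem_univ k) (hFu k u b hk hub h0)

end Likelihood

/-! ### Zeros of a saturation. -/

section Saturation

variable {τ : Type}

theorem aeval_eq_zero_of_mem_saturation {I J : Ideal (MvPolynomial τ ℂ)} {b : τ → ℂ}
    (hI : ∀ f ∈ I, aeval b f = 0) {y : MvPolynomial τ ℂ} (hy : y ∈ J) (hyb : aeval b y ≠ 0) :
    ∀ f ∈ saturation I J, aeval b f = 0 := by
  have hle : saturation I J ≤ RingHom.ker (aeval b : MvPolynomial τ ℂ →ₐ[ℂ] ℂ) := by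
    rw [saturation]
    refine iSup_le fun N f hf => ?_
    have h1 := Submodule.mem_colon.1 hf (y ^ N) (Ideal.pow_mem_pow hy N)
    have h2 := hI _ h1
    rw [smul_eq_mul, map_mul, map_pow] at h2
    exact (mul_eq_zero.1 h2).resolve_right (pow_ne_zero _ hyb)
  exact hle

theorem le_saturation (I J : Ideal (MvPolynomial τ ℂ)) : I ≤ saturation I J := by
  refine le_trans (fun f hf => ?_) (le_iSup _ 0)
  exact Submodule.mem_colon.2 fun y _ => Ideal.mul_mem_right _ _ hf

/-- A polynomial that vanishes on the zero set of `I` outside that of `J` vanishes on the zero set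
of the saturation. -/
theorem aeval_eq_zero_of_saturation [Finite τ] {I J : Ideal (MvPolynomial τ ℂ)} {f : MvPolynomial τ ℂ}
    (hf : ∀ b : τ → ℂ, (∀ h ∈ I, aeval b h = 0) → (∃ y ∈ J, aeval b y ≠ 0) → aeval b f = 0)
    {b : τ → ℂ} (hb : ∀ h ∈ saturation I J, aeval b h = 0) : aeval b f = 0 := by
  -- By the Nullstellensatz `f J` is in the radical of `I`; a power `N` of the radical lies in `I`,
  -- so `f ^ N` multiplies `J ^ N` into `I`.
  have hle : Ideal.span {f} * J ≤ I.radical := by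
    rw [← MvPolynomial.vanishingIdeal_zeroLocus_eq_radical (K := ℂ) I, Ideal.mul_le]
    intro g hg y hy
    obtain ⟨a, rfl⟩ := Ideal.mem_span_singleton'.1 hg
    rw [mem_vanishingIdeal_iff]
    intro z hz
    by_cases h : aeval z y = 0
    · rw [map_mul, h, mul_zero]
    · rw [map_mul, map_mul, hf z (fun h hh => mem_zeroLocus_iff.1 hz h hh) ⟨y, hy, h⟩]
      simp
  obtain ⟨N, hN⟩ := Ideal.exists_radical_pow_le_of_fg I (IsNoetherian.noetherian _)
  have h1 : f ^ N ∈ saturation I J := by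
    rw [saturation]
    refine Submodule.mem_iSup_of_mem N (Submodule.mem_colon.2 fun y hy => ?_)
    rw [smul_eq_mul]
    have h2 : f ^ N * y ∈ (Ideal.span {f} * J) ^ N := by
      rw [mul_pow, Ideal.span_singleton_pow]
      exact Ideal.mul_mem_mul (Ideal.mem_span_singleton_self _) hy
    exact hN (Ideal.pow_right_mono hle N h2)
  have h2 := hb _ h1
  rw [map_pow] at h2
  exact eq_zero_of_pow_eq_zero h2

end Saturation

/-! ### Generically reduced equations and the rank of their Jacobian. -/

section DefiningEquations

variable {σ : Type} {l c : ℕ} {g : Fin l → MvPolynomial σ ℂ} {Y : Set (ProjSpace σ)}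

theorem DefinesVariety.mem_homIdeal (hg : DefinesVariety g Y) (j : Fin l) : g j ∈ homIdeal Y := by
  rw [homIdeal, mem_vanishingIdeal_iff]
  intro v hv
  rw [← hg.zeros] at hv
  exact hv j

/-- The gradients of generically reduced defining equations span the normal space at the generic
point. -/
theorem DefinesVariety.gradient_mem_span [Fintype σ] (hg : DefinesVariety g Y) [(homIdeal Y).IsPrime]
    {h : MvPolynomial σ ℂ} (hh : h ∈ homIdeal Y) :
    gradient (genericPoint (homIdeal Y)) h ∈ Submodule.span (FunctionField (homIdeal Y))
      (Set.range fun j => gradient (genericPoint (homIdeal Y)) (g j)) := by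
  obtain ⟨H, hH, hspan⟩ := hg.genericallyReduced
  obtain ⟨a, ha⟩ := Ideal.mem_span_range_iff_exists_fun.1 (hspan h hh)
  have hH0 : aeval (genericPoint (homIdeal Y)) H ≠ 0 := fun h0 =>
    hH ((aeval_genericPoint_eq_zero _).1 h0)
  -- Both `h` and the `g j` vanish at the generic point, so the product rule leaves `H ∇h = ∑ a_j
  -- ∇g_j` there, and `H` is invertible.
  have h1 : gradient (genericPoint (homIdeal Y)) (H * h) =
      aeval (genericPoint (homIdeal Y)) H • gradient (genericPoint (homIdeal Y)) h := by
    rw [gradient_mul, (aeval_genericPoint_eq_zero _).2 hh, zero_smul, add_zero]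
  have h2 : gradient (genericPoint (homIdeal Y)) (H * h) =
      ∑ j, aeval (genericPoint (homIdeal Y)) (a j) • gradient (genericPoint (homIdeal Y)) (g j) := by
    have h3 : gradient (genericPoint (homIdeal Y)) (∑ j, a j * g j) =
        ∑ j, gradient (genericPoint (homIdeal Y)) (a j * g j) := by
      ext i
      simp [gradient]
    rw [← ha, h3]
    refine Finset.sum_congr rfl fun j _ => ?_
    rw [gradient_mul, (aeval_genericPoint_eq_zero _).2 (hg.mem_homIdeal j), zero_smul, add_zero]
  rw [← Submodule.smul_mem_iff _ hH0, ← h1, h2]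
  exact Submodule.sum_mem _ fun j _ => Submodule.smul_mem _ _ (Submodule.subset_span ⟨j, rfl⟩)

theorem DefinesVariety.exists_jacobianMinor [Fintype σ] (hg : DefinesVariety g Y)
    (hY : (homIdeal Y).IsPrime)
    (hc : HasCodim Y c) :
    ∃ (a : Fin c → Fin l) (s : Fin c → σ), jacobianMinor g a s ∉ homIdeal Y ∧
      ∀ (E : Type) [Field E] [Algebra ℂ E] (y : σ → E), (∀ h ∈ homIdeal Y, aeval y h = 0) →
        aeval y (jacobianMinor g a s) ≠ 0 → normalSpan (homIdeal Y : Set (MvPolynomial σ ℂ)) y =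
          Submodule.span E (Set.range fun j => gradient y (g (a j))) := by
  obtain ⟨r, a, s, hr, hm, hspan⟩ := DualMLE.exists_jacobianMinor (homIdeal Y) g hg.mem_homIdeal
    (fun h hh => hg.gradient_mem_span hh)
  obtain ⟨d, -, -, hd, -⟩ := finrank_normalSpan_genericPoint (homIdeal Y)
  have : r = c := by
    rw [HasCodim, coneDim, hd] at hc
    rw [hd] at hr
    have hc' : d + c = Fintype.card σ := by exact_mod_cast hc
    have hr' : d + r = Fintype.card σ := by exact_mod_cast hr
    omega
  subst this
  exact ⟨a, s, hm, hspan⟩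

/-- Euler's relation for normal vectors of a cone. -/
theorem IsIrreducibleCone.sum_mul_eq_zero [Fintype σ] {V : Set (σ → ℂ)} (hV : IsIrreducibleCone V)
    {v z : σ → ℂ} (hv : v ∈ V) (hz : z ∈ normalSpan (vanishingIdeal ℂ V : Set (MvPolynomial σ ℂ)) v) :
    ∑ i, v i * z i = 0 := by
  have hle : normalSpan (vanishingIdeal ℂ V : Set (MvPolynomial σ ℂ)) v ≤
      LinearMap.ker (dotProductBilin ℂ ℂ v) := by
    rw [normalSpan, Submodule.span_le]
    rintro _ ⟨f, hf, rfl⟩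
    have := mem_vanishingIdeal_iff.1 (hV.sum_X_mul_pderiv_mem hf) v hv
    simpa [gradient, dotProduct] using this
  exact hle hz

end DefiningEquations

/-! ### The determinantal equations at a complex point. -/

section DualLikelihood

variable {n l c : ℕ}

theorem aeval_shift (b : Fin (n + 2) → ℂ) (f : MvPolynomial (Fin (n + 1)) ℂ) :
    aeval b (shift n f) = aeval (shiftVec b) f := by
  rw [shift, comp_aeval_apply]
  congr 2
  ext i
  simp [shiftVec_apply]

theorem isHomogeneous_shift {f : MvPolynomial (Fin (n + 1)) ℂ} {d : ℕ} (hf : f.IsHomogeneous d) :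
    (shift n f).IsHomogeneous d := by
  have := hf.aeval (fun i : Fin (n + 1) => (X i.castSucc + X (Fin.last (n + 1)) :
    MvPolynomial (Fin (n + 2)) ℂ)) (n := 1)
    (fun i => (isHomogeneous_X _ _).add (isHomogeneous_X _ _))
  rw [one_mul] at this
  exact this

theorem aeval_extendedJacobian (g : Fin l → MvPolynomial (Fin (n + 1)) ℂ) (u : Fin (n + 1) → ℂ)
    (b : Fin (n + 2) → ℂ) (j : Fin (l + 1)) (i : Fin (n + 1)) :
    aeval b (extendedJacobian g u j i) =
      (Fin.cons u fun j i => gradient (shiftVec b) (g j) i * b i.castSucc :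
        Fin (l + 1) → Fin (n + 1) → ℂ) j i := by
  refine Fin.cases ?_ (fun j => ?_) j
  · simp [extendedJacobian]
  · have h : extendedJacobian g u j.succ i = shiftedJacobian g j i * X i.castSucc :=
      Matrix.mul_diagonal (fun i : Fin (n + 1) => (X i.castSucc : MvPolynomial (Fin (n + 2)) ℂ))
        (shiftedJacobian g) j i
    rw [h, map_mul, aeval_X, shiftedJacobian, Matrix.of_apply, aeval_shift,
      Fin.cons_succ, gradient]

theorem aeval_det_submatrix {a d k : ℕ} (M : Matrix (Fin a) (Fin d) (MvPolynomial (Fin (n + 2)) ℂ))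
    (b : Fin (n + 2) → ℂ) (r : Fin k → Fin a) (s : Fin k → Fin d) :
    aeval b (M.submatrix r s).det = (Matrix.of fun i j => aeval b (M (r i) (s j))).det := by
  rw [AlgHom.map_det]
  rfl

/-- The equations before saturation. -/
def criticalIdeal (g : Fin l → MvPolynomial (Fin (n + 1)) ℂ) (c : ℕ) (u : Fin (n + 1) → ℂ) :
    Ideal (MvPolynomial (Fin (n + 2)) ℂ) :=
  Ideal.span (Set.range fun j => shift n (g j)) ⊔ minorsIdeal (c + 1) (extendedJacobian g u)

theorem aeval_eq_zero_of_mem_criticalIdeal_iff {g : Fin l → MvPolynomial (Fin (n + 1)) ℂ}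
    {u : Fin (n + 1) → ℂ} {b : Fin (n + 2) → ℂ} :
    (∀ f ∈ criticalIdeal g c u, aeval b f = 0) ↔
      (∀ j, aeval (shiftVec b) (g j) = 0) ∧
        ∀ (r : Fin (c + 1) ↪o Fin (l + 1)) (s : Fin (c + 1) ↪o Fin (n + 1)),
          aeval b ((extendedJacobian g u).submatrix r s).det = 0 := by
  change criticalIdeal g c u ≤ RingHom.ker (aeval b : MvPolynomial (Fin (n + 2)) ℂ →ₐ[ℂ] ℂ) ↔ _
  rw [criticalIdeal, sup_le_iff, Ideal.span_le, minorsIdeal, Ideal.span_le]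
  refine and_congr ?_ ?_
  · rw [Set.range_subset_iff]
    simp only [← aeval_shift]
    rfl
  · constructor
    · intro h r s
      exact h ⟨r, s, rfl⟩
    · rintro h _ ⟨r, s, rfl⟩
      exact h r s

variable {X : Set (ProjSpace (Fin (n + 1)))} {g : Fin l → MvPolynomial (Fin (n + 1)) ℂ}
  {u : Fin (n + 1) → ℂ} {b : Fin (n + 2) → ℂ}

/-- If the minors of size `c + 1` vanish and a minor of the Jacobian of size `c` does not, then the
top row is a combination of the gradients. -/
theorem mem_span_of_mem_criticalIdeal (hI : ∀ f ∈ criticalIdeal g c u, aeval b f = 0)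
    (hb : ∀ i, b i ≠ 0) {δ : MvPolynomial (Fin (n + 2)) ℂ} (hδ : δ ∈ minorsIdeal c (shiftedJacobian g))
    (hδb : aeval b δ ≠ 0) :
    (fun i : Fin (n + 1) => u i / b i.castSucc) ∈
      Submodule.span ℂ (Set.range fun j => gradient (shiftVec b) (g j)) := by
  have hminors := (aeval_eq_zero_of_mem_criticalIdeal_iff.1 hI).2
  obtain ⟨r, s, hrs⟩ : ∃ (r : Fin c ↪o Fin l) (s : Fin c ↪o Fin (n + 1)),
      aeval b ((shiftedJacobian g).submatrix r s).det ≠ 0 := by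
    by_contra! h
    apply hδb
    have hle : minorsIdeal c (shiftedJacobian g) ≤
        RingHom.ker (aeval b : MvPolynomial (Fin (n + 2)) ℂ →ₐ[ℂ] ℂ) := by
      rw [minorsIdeal, Ideal.span_le]
      rintro _ ⟨r, s, rfl⟩
      exact h r s
    exact hle hδ
  have hlin : LinearIndependent ℂ fun j => gradient (shiftVec b) (g (r j)) := by
    refine linearIndependent_of_aeval_jacobianMinor g r s (y := shiftVec b) ?_
    rw [← aeval_shift]
    convert! hrs using 2
    rw [jacobianMinor, AlgHom.map_det]
    rfl
  refine Submodule.span_mono (Set.range_comp_subset_range r fun j => gradient (shiftVec b) (g j)) ?_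
  by_contra hnot
  have hlin2 := linearIndependent_finCons.2 ⟨hlin, hnot⟩
  -- Multiplying the columns by the nonzero `b_i` preserves independence, so if the top row were
  -- outside the span, the extended matrix would have a nonzero minor of size `c + 1`.
  have hinj : Function.Injective (LinearMap.mulRight ℂ (fun i : Fin (n + 1) => b i.castSucc)) := by
    intro v w hvw
    ext i
    exact mul_right_cancel₀ (hb i.castSucc) (congr_fun hvw i)
  have hlin3 := hlin2.map' _ (LinearMap.ker_eq_bot.2 hinj)
  obtain ⟨s', hs'⟩ := exists_det_ne_zero _ hlin3
  obtain ⟨r'', s'', h⟩ := exists_orderEmbedding_det_ne_zero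
    (Matrix.of fun j i => aeval b (extendedJacobian g u j i))
    (Fin.cons 0 fun j => (r j).succ : Fin (c + 1) → Fin (l + 1)) s' ⊥ (by
      rw [Ideal.mem_bot]
      convert! hs' using 3
      ext j k
      rw [Matrix.submatrix_apply, Matrix.of_apply, aeval_extendedJacobian]
      refine Fin.cases ?_ (fun j => ?_) j
      · simp [div_mul_cancel₀ _ (hb _)]
      · simp)
  exact h (by
    rw [Ideal.mem_bot]
    exact (aeval_det_submatrix _ b r'' s'').symm.trans (hminors r'' s''))

/-- If the top row is a combination of `c` gradients that span all of them, then the minors of size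
`c + 1` vanish. -/
theorem aeval_eq_zero_of_mem_span (hg : ∀ j, aeval (shiftVec b) (g j) = 0) {a : Fin c → Fin l}
    (ha : ∀ j, gradient (shiftVec b) (g j) ∈
      Submodule.span ℂ (Set.range fun k => gradient (shiftVec b) (g (a k))))
    {p : Fin (n + 1) → ℂ}
    (hp : p ∈ Submodule.span ℂ (Set.range fun k => gradient (shiftVec b) (g (a k))))
    (hpu : ∀ i : Fin (n + 1), p i * b i.castSucc = u i) :
    ∀ f ∈ criticalIdeal g c u, aeval b f = 0 := by
  rw [aeval_eq_zero_of_mem_criticalIdeal_iff]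
  refine ⟨hg, fun r s => ?_⟩
  rw [aeval_det_submatrix]
  simp only [aeval_extendedJacobian]
  set D := LinearMap.mulRight ℂ (fun i : Fin (n + 1) => b i.castSucc) with hD
  -- All rows of the extended matrix lie in the image under column scaling of a space spanned by `c`
  -- vectors.
  refine det_eq_zero_of_mem_submodule ((Submodule.span ℂ
    (Set.range fun k => gradient (shiftVec b) (g (a k)))).map D) ?_
    (fun j => (Fin.cons u fun j i => gradient (shiftVec b) (g j) i * b i.castSucc :
        Fin (l + 1) → Fin (n + 1) → ℂ) (r j)) (fun j => ?_) s
  · refine (Submodule.finrank_map_le _ _).trans ?_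
    refine (finrank_range_le_card _).trans ?_
    simp
  · generalize r j = j'
    refine Fin.cases ?_ (fun j => ?_) j'
    · exact ⟨p, hp, by ext i; exact hpu i⟩
    · exact ⟨_, ha j, by ext i; rfl⟩

end DualLikelihood

/-! ### The likelihood locus, the critical points and the main theorem. -/

section CriticalPoints

variable {n l c : ℕ} {X : Set (ProjSpace (Fin (n + 1)))} {u : Fin (n + 1) → ℂ}

theorem extData_castSucc (u : Fin (n + 1) → ℂ) (i : Fin (n + 1)) : extData u i.castSucc = u i := by
  simp [extData]

theorem extData_last (u : Fin (n + 1) → ℂ) : extData u (Fin.last (n + 1)) = -∑ i, u i := by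
  simp [extData]

theorem extData_ne_zero (hu : u ≠ 0) : extData u ≠ 0 := by
  intro h
  apply hu
  ext i
  rw [← extData_castSucc u i, h]
  rfl

/-- The projective scalar is absorbed into `p`, as the conormal equations are stable under
rescaling; `u ≠ 0` ensures that such a `p` is a projective point. -/
theorem mem_dualLikelihoodLocus_iff (hX : (homIdeal X).IsPrime) (hne : X.Nonempty) (hu : u ≠ 0)
    {x : ProjSpace (Fin (n + 2))} :
    x ∈ dualLikelihoodLocus X u ↔ ∃ p : Fin (n + 2) → ℂ,
      (∀ F ∈ conormalIdeal (affineCone (sumEmbedding X)), aeval (Sum.elim p x.rep) F = 0) ∧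
        ∀ i, p i * x.rep i = extData u i := by
  have hX' := isPrime_homIdeal_sumEmbedding hX
  have hV' := isIrreducibleCone_affineCone hX'
  have hne' := sumEmbedding_nonempty hne
  constructor
  · rintro ⟨⟨y, x⟩, ⟨hyx, t, ht, h⟩, rfl⟩
    refine ⟨t⁻¹ • y.rep, ?_, fun i => ?_⟩
    · have := hV'.zeroLocus_conormalIdeal_smul (s := 1) (inv_ne_zero ht)
        ((mem_conormalVariety_iff hX' hne').1 hyx)
      rwa [one_smul] at this
    · have := h i
      simp only at this
      simp only [Pi.smul_apply, smul_eq_mul, mul_assoc, this]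
      field_simp
  · rintro ⟨p, hp, h⟩
    have hp0 : p ≠ 0 := by
      rintro rfl
      apply extData_ne_zero hu
      ext i
      rw [← h i]
      simp
    obtain ⟨t, ht, hpt⟩ := exists_smul_rep hp0
    have hpt' : (Projectivization.mk ℂ p hp0).rep = t⁻¹ • p := by
      conv_rhs => rw [hpt]
      rw [smul_smul, inv_mul_cancel₀ ht, one_smul]
    refine ⟨(Projectivization.mk ℂ p hp0, x), ⟨?_, t⁻¹, inv_ne_zero ht, fun i => ?_⟩, rfl⟩
    · rw [mem_conormalVariety_iff hX' hne', hpt']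
      have := hV'.zeroLocus_conormalIdeal_smul (s := 1) (inv_ne_zero ht) hp
      rwa [one_smul] at this
    · simp only [hpt', Pi.smul_apply, smul_eq_mul, ← h i, mul_assoc]

theorem mem_dualCriticalPoints_iff {x : ProjSpace (Fin (n + 2))} :
    x ∈ dualCriticalPoints X u ↔ x ∈ regularPoints (dualVariety (sumEmbedding X)) ∧
      (∀ i, x.rep i ≠ 0) ∧ (fun i => extData u i / x.rep i) ∈
        normalSpan (homIdeal (dualVariety (sumEmbedding X)) : Set (MvPolynomial (Fin (n + 2)) ℂ))
          x.rep := by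
  rw [← orthogonal_tangentSpace_iff]
  rfl

/-- The coordinates do not vanish identically on the dual variety of `X'`, and neither do the
polynomials in the `b_i + b_s` that are nonzero on the dual variety of `X`. -/
theorem rename_inr_notMem_conormalIdeal_sumEmbedding (hX : (homIdeal X).IsPrime) (hne : X.Nonempty)
    {m : MvPolynomial (Fin (n + 1)) ℂ} (hm : m ∉ homIdeal (dualVariety X)) :
    rename Sum.inr ((∏ i : Fin (n + 2), MvPolynomial.X i) * shift n m) ∉
      conormalIdeal (affineCone (sumEmbedding X)) := by
  have := conormalIdeal_isPrime (isIrreducibleCone_affineCone (isPrime_homIdeal_sumEmbedding hX))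
  rw [map_mul, map_prod]
  simp only [rename_X]
  intro h
  rcases Ideal.IsPrime.mem_or_mem this h with h | h
  · obtain ⟨i, -, hi⟩ := (Ideal.IsPrime.prod_mem_iff (hp := this)).1 h
    -- The covector `(-1, …, -1, 1)` of the hyperplane containing `X'` is killed by `shiftVec` and
    -- has no zero coordinate.
    have h1 := mem_vanishingIdeal_iff.1 hi (Sum.elim (sumExt 0)
      (Fin.snoc (α := fun _ => ℂ) (fun _ => -1) 1)) (mem_conormalCone_sumEmbedding.2 ⟨0, rfl,
        mem_conormalCone.2 ⟨fun h => absurd rfl h, by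
          convert! Submodule.zero_mem _
          ext i
          simp [shiftVec_apply]⟩⟩)
    rw [aeval_X, Sum.elim_inr] at h1
    revert h1
    refine Fin.lastCases ?_ (fun i => ?_) i <;> simp
  · apply hm
    rw [homIdeal_dualVariety hX hne, Ideal.mem_comap, conormalIdeal, mem_vanishingIdeal_iff]
    intro z hz
    rw [← Sum.elim_comp_inl_inr z] at hz ⊢
    -- Setting `b_s = 0` lifts any conormal vector `q` of `X` to one of `X'`.
    have hb : shiftVec (Fin.snoc (α := fun _ => ℂ) (z ∘ Sum.inr) 0 : Fin (n + 2) → ℂ) =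
        z ∘ Sum.inr := by
      ext i
      simp [shiftVec_apply]
    have h1 := mem_vanishingIdeal_iff.1 h (Sum.elim (sumExt (z ∘ Sum.inl))
      (Fin.snoc (α := fun _ => ℂ) (z ∘ Sum.inr) 0)) (mem_conormalCone_sumEmbedding.2 ⟨_, rfl, by
        rw [hb]
        exact hz⟩)
    rw [aeval_rename, Sum.elim_comp_inr, aeval_shift, hb] at h1
    rw [aeval_rename, Sum.elim_comp_inr]
    exact h1

/-- Solutions of the dual likelihood equations outside the exceptional locus are conormal. -/
theorem aeval_eq_zero_of_mem_criticalIdeal (hX : (homIdeal X).IsPrime) (hne : X.Nonempty)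
    {g : Fin l → MvPolynomial (Fin (n + 1)) ℂ} (hg : DefinesVariety g (dualVariety X))
    {b : Fin (n + 2) → ℂ} (hI : ∀ f ∈ criticalIdeal g c u, aeval b f = 0) (hb : ∀ i, b i ≠ 0)
    {δ : MvPolynomial (Fin (n + 2)) ℂ} (hδ : δ ∈ minorsIdeal c (shiftedJacobian g))
    (hδb : aeval b δ ≠ 0) :
    ∀ F ∈ conormalIdeal (affineCone (sumEmbedding X)),
      aeval (Sum.elim (fun i => extData u i / b i) b) F = 0 := by
  have hV := isIrreducibleCone_affineCone hX
  have hVd := isIrreducibleCone_affineCone (isPrime_homIdeal_dualVariety hX hne)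
  have hspan := mem_span_of_mem_criticalIdeal hI hb hδ hδb
  set p : Fin (n + 1) → ℂ := fun i => u i / b i.castSucc with hp
  have hq : shiftVec b ∈ affineCone (dualVariety X) := by
    rw [← hg.zeros]
    exact (aeval_eq_zero_of_mem_criticalIdeal_iff.1 hI).1
  have hpn : p ∈ normalSpan (homIdeal (dualVariety X) : Set (MvPolynomial (Fin (n + 1)) ℂ))
      (shiftVec b) := by
    refine (Submodule.span_le.2 ?_) hspan
    rintro _ ⟨j, rfl⟩
    exact gradient_mem_normalSpan _ (hg.mem_homIdeal j)
  rw [zeroLocus_conormalIdeal_sumEmbedding]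
  refine ⟨p, ?_, fun F hF => ?_⟩
  · rw [eq_sumExt_iff]
    refine ⟨fun i => by rw [extData_castSucc], ?_⟩
    -- Euler's relation for `X^*` reads `∑ (b_i + b_s) p_i = 0`, that is, `b_s ∑ p_i = -u_+`: the
    -- coordinate `p_s` is the required one.
    have h1 := hVd.sum_mul_eq_zero hq hpn
    simp only [shiftVec_apply, add_mul, Finset.sum_add_distrib, ← Finset.mul_sum] at h1
    have h2 : ∑ i : Fin (n + 1), b i.castSucc * p i = ∑ i, u i :=
      Finset.sum_congr rfl fun i _ => mul_div_cancel₀ _ (hb _)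
    rw [extData_last, div_eq_iff (hb _)]
    rw [h2] at h1
    linear_combination -h1
  · have h1 := (rename_swap_mem_conormalIdeal_iff hV hVd (homIdeal_dualVariety hX hne) F).2 hF
    have h2 := mem_vanishingIdeal_iff.1 h1 _ (mem_conormalCone.2 ⟨hq, hpn⟩)
    rw [aeval_rename] at h2
    rw [← h2]
    congr 2
    ext i
    cases i <;> rfl

/-- Bridges arbitrary index functions in `jacobianMinor` and increasing ones in `minorsIdeal`. -/
theorem exists_shiftedJacobian_minor {g : Fin l → MvPolynomial (Fin (n + 1)) ℂ} {a : Fin c → Fin l}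
    {s : Fin c → Fin (n + 1)} {b : Fin (n + 2) → ℂ}
    (h : aeval (shiftVec b) (jacobianMinor g a s) ≠ 0) :
    ∃ δ ∈ minorsIdeal c (shiftedJacobian g), aeval b δ ≠ 0 := by
  obtain ⟨r', s', h'⟩ := exists_orderEmbedding_det_ne_zero (shiftedJacobian g) a s
    (RingHom.ker (aeval b : MvPolynomial (Fin (n + 2)) ℂ →ₐ[ℂ] ℂ)) (by
      rw [RingHom.mem_ker]
      rw [← aeval_shift, jacobianMinor, AlgHom.map_det] at h
      exact h)
  exact ⟨_, Ideal.subset_span ⟨r', s', rfl⟩, h'⟩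

/-- The dual likelihood equations for generic data. -/
theorem dualLikelihood_generic (hX : IsProjectiveVariety X)
    {g : Fin l → MvPolynomial (Fin (n + 1)) ℂ} (hg : DefinesVariety g (dualVariety X))
    (hc : HasCodim (dualVariety X) c) :
    ∃ F : MvPolynomial (Fin (n + 1)) ℂ, F ≠ 0 ∧ ∀ u : Fin (n + 1) → ℂ, eval u F ≠ 0 →
      dualLikelihoodLocus X u = projZeros (dualLikelihoodIdeal g c u : Set _) ∧
        dualCriticalPoints X u = projZeros (dualLikelihoodIdeal g c u : Set _) := by
  have hne := hX.nonempty
  have hP := hX.irreducible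
  have hP' := isPrime_homIdeal_sumEmbedding hP
  have hne' := sumEmbedding_nonempty hne
  have hV := isIrreducibleCone_affineCone hP
  have hV' := isIrreducibleCone_affineCone hP'
  have hdual := homIdeal_dualVariety hP hne
  have hdual' := homIdeal_dualVariety hP' hne'
  have hD' := isPrime_homIdeal_dualVariety hP' hne'
  have hVd' := isIrreducibleCone_affineCone hD'
  obtain ⟨a, s, hm, hspan⟩ :=
    hg.exists_jacobianMinor (isPrime_homIdeal_dualVariety hP hne) hc
  obtain ⟨r, a', s', -, hm', hspan', hreg⟩ := exists_jacobianMinor_regular hD'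
    (fun f : {f : MvPolynomial (Fin (n + 2)) ℂ //
      f ∈ vanishingIdeal ℂ (affineCone (dualVariety (sumEmbedding X))) ∧ ∃ d, f.IsHomogeneous d} =>
        f.1) (fun f => f.2.1) (fun h hh => hVd'.gradient_mem_span_homogeneous _ hh)
  obtain ⟨dm, hdm⟩ := isHomogeneous_jacobianMinor hg.homogeneous a s
  -- `F₁` keeps `b` off the coordinate hyperplanes and off a maximal minor for `X^*`; `F₂` keeps it
  -- off a Jacobian minor of `X'^*`, which gives regularity. The factor `X 0` below only serves to
  -- force `u ≠ 0`.
  obtain ⟨F₁, hF₁, hF₁u⟩ := exists_generic_ne_zero hV'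
    (rename_inr_notMem_conormalIdeal_sumEmbedding hP hne hm)
    ⟨_, (IsHomogeneous.prod _ _ (fun _ => 1) fun i _ => isHomogeneous_X _ _).mul
      (isHomogeneous_shift hdm)⟩
  obtain ⟨F₂, hF₂, hF₂u⟩ := exists_generic_ne_zero hV' (fun h => hm' (hdual' ▸ h))
    (isHomogeneous_jacobianMinor (fun f => f.2.2) a' s')
  refine ⟨F₁ * F₂ * MvPolynomial.X 0, mul_ne_zero (mul_ne_zero hF₁ hF₂) (X_ne_zero _),
    fun u hu => ?_⟩
  rw [map_mul, map_mul, eval_X] at hu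
  have hu1 : aeval u F₁ ≠ 0 := left_ne_zero_of_mul (left_ne_zero_of_mul hu)
  have hu2 : aeval u F₂ ≠ 0 := right_ne_zero_of_mul (left_ne_zero_of_mul hu)
  have hu0 : u ≠ 0 := fun h => right_ne_zero_of_mul hu (by rw [h]; rfl)
  have hgen : ∀ b : Fin (n + 2) → ℂ, b ≠ 0 →
      (∀ Φ ∈ likelihoodIdeal (affineCone (sumEmbedding X)), aeval (Sum.elim u b) Φ = 0) →
        (∀ i, b i ≠ 0) ∧ aeval (shiftVec b) (jacobianMinor g a s) ≠ 0 := by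
    intro b hb hQ
    have h := hF₁u u b hu1 hb hQ
    rw [map_mul, map_prod, aeval_shift] at h
    refine ⟨fun i => ?_, right_ne_zero_of_mul h⟩
    have := Finset.prod_ne_zero_iff.1 (left_ne_zero_of_mul h) i (Finset.mem_univ i)
    rwa [aeval_X] at this
  have hQ : ∀ {p b : Fin (n + 2) → ℂ},
      (∀ F ∈ conormalIdeal (affineCone (sumEmbedding X)), aeval (Sum.elim p b) F = 0) →
      (∀ i, p i * b i = extData u i) →
        ∀ Φ ∈ likelihoodIdeal (affineCone (sumEmbedding X)), aeval (Sum.elim u b) Φ = 0 := by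
    intro p b hp hpu Φ hΦ
    have h1 := hp _ (mem_likelihoodIdeal.1 hΦ)
    rw [aeval_productSubst] at h1
    simpa only [hpu, extData_castSucc] using h1
  have hAB : dualLikelihoodLocus X u = projZeros (dualLikelihoodIdeal g c u : Set _) := by
    ext x
    rw [mem_dualLikelihoodLocus_iff hP hne hu0]
    constructor
    · rintro ⟨p, hp, hpu⟩
      obtain ⟨hb, hmb⟩ := hgen x.rep x.rep_nonzero (hQ hp hpu)
      obtain ⟨p₀, rfl, hp₀⟩ := zeroLocus_conormalIdeal_sumEmbedding.1 hp
      have hvan : ∀ h ∈ homIdeal (dualVariety X), aeval (shiftVec x.rep) h = 0 := by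
        intro h hh
        rw [hdual, Ideal.mem_comap] at hh
        have h1 := hp₀ _ hh
        rwa [aeval_rename, Sum.elim_comp_inr] at h1
      have hI : ∀ f ∈ criticalIdeal g c u, aeval x.rep f = 0 := by
        refine aeval_eq_zero_of_mem_span (fun j => hvan _ (hg.mem_homIdeal j)) (a := a)
          (fun j => ?_) (p := p₀)
          (mem_span_of_mem_zeroLocus_conormalIdeal hV hdual hm hspan hp₀ hmb) (fun i => ?_)
        · rw [← hspan ℂ _ hvan hmb]
          exact gradient_mem_normalSpan _ (hg.mem_homIdeal j)
        · have := hpu i.castSucc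
          rwa [sumExt_castSucc, extData_castSucc] at this
      obtain ⟨δ, hδ, hδb⟩ := exists_shiftedJacobian_minor hmb
      refine aeval_eq_zero_of_mem_saturation hI
        (Ideal.mul_mem_mul (Ideal.mem_span_singleton_self _) hδ) ?_
      rw [map_mul, map_prod]
      refine mul_ne_zero (Finset.prod_ne_zero_iff.2 fun i _ => ?_) hδb
      rw [aeval_X]
      exact hb i
    · intro hx
      have hx' : ∀ f ∈ dualLikelihoodIdeal g c u, aeval x.rep f = 0 := hx
      have key : ∀ b : Fin (n + 2) → ℂ, (∀ f ∈ criticalIdeal g c u, aeval b f = 0) →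
          (∃ y ∈ Ideal.span {∏ i : Fin (n + 2), MvPolynomial.X i} *
            minorsIdeal c (shiftedJacobian g), aeval b y ≠ 0) →
          (∀ i, b i ≠ 0) ∧ ∃ δ ∈ minorsIdeal c (shiftedJacobian g), aeval b δ ≠ 0 := by
        rintro b hI ⟨y, hy, hyb⟩
        obtain ⟨δ, hδ, rfl⟩ := Ideal.mem_span_singleton_mul.1 hy
        rw [map_mul, map_prod] at hyb
        refine ⟨fun i => ?_, δ, hδ, right_ne_zero_of_mul hyb⟩
        have := Finset.prod_ne_zero_iff.1 (left_ne_zero_of_mul hyb) i (Finset.mem_univ i)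
        rwa [aeval_X] at this
      -- A zero of the saturation may a priori be only a limit of good solutions. The equations of
      -- the closed family pass to the limit, and `hgen` then shows that the limit is itself off the
      -- exceptional locus.
      have hQx : ∀ Φ ∈ likelihoodIdeal (affineCone (sumEmbedding X)),
          aeval (Sum.elim u x.rep) Φ = 0 := by
        intro Φ hΦ
        let Φu : MvPolynomial (Fin (n + 2)) ℂ :=
          aeval (Sum.elim (fun i => C (u i)) MvPolynomial.X) Φ
        have hΦu : ∀ b : Fin (n + 2) → ℂ, aeval b Φu = aeval (Sum.elim u b) Φ := by
          intro b
          rw [comp_aeval_apply]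
          congr 2
          ext i
          cases i <;> simp
        rw [← hΦu]
        refine aeval_eq_zero_of_saturation (fun b hI hy => ?_) hx'
        obtain ⟨hb, δ, hδ, hδb⟩ := key b hI hy
        rw [hΦu]
        exact hQ (aeval_eq_zero_of_mem_criticalIdeal hP hne hg hI hb hδ hδb)
          (fun i => div_mul_cancel₀ _ (hb i)) Φ hΦ
      obtain ⟨hb, hmb⟩ := hgen x.rep x.rep_nonzero hQx
      obtain ⟨δ, hδ, hδb⟩ := exists_shiftedJacobian_minor hmb
      exact ⟨_, aeval_eq_zero_of_mem_criticalIdeal hP hne hg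
        (fun f hf => hx' f (le_saturation _ _ hf)) hb hδ hδb, fun i => div_mul_cancel₀ _ (hb i)⟩
  refine ⟨hAB, ?_⟩
  rw [← hAB]
  ext x
  rw [mem_dualCriticalPoints_iff]
  constructor
  · rintro ⟨hx, hb, hn⟩
    rw [mem_dualLikelihoodLocus_iff hP hne hu0]
    refine ⟨_, fun F hF => ?_, fun i => div_mul_cancel₀ _ (hb i)⟩
    -- Reflexivity for `X'` turns a normal vector of `X'^*` at `b` into a conormal pair of `X'`.
    have h1 := (rename_swap_mem_conormalIdeal_iff hV' hVd' hdual' F).2 hF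
    have h2 := mem_vanishingIdeal_iff.1 h1 _
      (mem_conormalCone.2 ⟨rep_mem_affineCone.2 hx.1, hn⟩)
    rw [aeval_rename] at h2
    rw [← h2]
    congr 2
    ext i
    cases i <;> rfl
  · intro hx
    have hxY : x ∈ dualVariety (sumEmbedding X) := by
      obtain ⟨z, hz, rfl⟩ := hx
      exact ⟨z, hz.1, rfl⟩
    obtain ⟨p, hp, hpu⟩ := (mem_dualLikelihoodLocus_iff hP hne hu0).1 hx
    have hQx := hQ hp hpu
    have hb := (hgen x.rep x.rep_nonzero hQx).1
    have hmx := hF₂u u x.rep hu2 x.rep_nonzero hQx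
    refine ⟨hreg x hxY hmx, hb, ?_⟩
    -- As no coordinate of `b` vanishes, `p` is the gradient vector itself, and at this regular
    -- point it is normal to `X'^*`.
    have hpe : p = fun i => extData u i / x.rep i := by
      ext i
      rw [eq_div_iff (hb i), hpu]
    rw [← hpe, hspan' ℂ x.rep
      (fun h hh => mem_vanishingIdeal_iff.1 hh _ (rep_mem_affineCone.2 hxY)) hmx]
    exact mem_span_of_mem_zeroLocus_conormalIdeal hV' hdual' hm' hspan' hp hmx

end CriticalPoints

end DualMLE

end

theorem theorem3p1 (n l c : ℕ) (X : Set (DualMLE.ProjSpace (Fin (n + 1))))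
    (hX : DualMLE.IsProjectiveVariety X)
    (g : Fin l → MvPolynomial (Fin (n + 1)) ℂ)
    (hg : DualMLE.DefinesVariety g (DualMLE.dualVariety X))
    (hc : DualMLE.HasCodim (DualMLE.dualVariety X) c) :
    ∃ F : MvPolynomial (Fin (n + 1)) ℂ, F ≠ 0 ∧
      ∀ u : Fin (n + 1) → ℂ, MvPolynomial.eval u F ≠ 0 →
        DualMLE.dualLikelihoodLocus X u =
            DualMLE.projZeros (DualMLE.dualLikelihoodIdeal g c u : Set (MvPolynomial (Fin (n + 2)) ℂ)) ∧
          DualMLE.dualCriticalPoints X u =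
            DualMLE.projZeros (DualMLE.dualLikelihoodIdeal g c u : Set (MvPolynomial (Fin (n + 2)) ℂ)) :=
  DualMLE.dualLikelihood_generic hX hg hc
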